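/- **Notation.** Put $\lambda_k=k(k+5)$, $d=8$, $b=0.33$, $d_0=16$, $m_0=0.04$. Let $C_k^\nu$ be the Gegenbauer polynomials, $F_k=\frac{k!\,\Gamma(5)}{\Gamma(k+5)}C_k^{5/2}$ (so $F_k(1)=1$), $\widetilde F_k'=\frac{6}{\lambda_k}F_k'$ (so $\widetilde F_k'(1)=1$), and $c_k=\max_{0\le x\le 1}|\widetilde F_{k+1}'(x)-\widetilde F_k'(x)|$. For $\alpha\ge\frac12$ and an integer $n$ put $$B_k=\frac{9\alpha^2}{32}\Big(\lambda_{n+1}-\lambda_k+\frac{11}{7\alpha}\Big)(2k+5).$$ For $a>0$ and $\frac12\le\lambda\le1$ write $a_+=\lambda a$, $a_-=(1-\lambda)a$, and for $\lambda_k\le\lambda_n$ let $$\mathcal A_k^+=\begin{cases}a_+-\frac{1-b}{d}\lambda_ka_+^2,&\lambda_k\le\frac{\lambda_n}{4},\\ ba_++(1-b)\frac{d}{4\lambda_k},&\frac{\lambda_n}{4}<\lambda_k\le\lambda_n,\end{cases}\qquad \mathcal A_k^-=\begin{cases}a_--\frac{1-b}{d}\lambda_ka_-^2,&a_-\le\frac{4}{\lambda_k},\\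 ba_-+(1-b)\frac{d}{4\lambda_k},&a_->\frac{4}{\lambda_k}.\end{cases}$$ Define $$f_{k,a}(\lambda)=B_k\big(|\mathcal A_k^+|^2+|\mathcal A_k^-|^2\big)+B_{k+1}\big(|\mathcal A_{k+1}^+|^2+|\mathcal A_{k+1}^-|^2\big)+2(B_k+B_{k+1})c_k\lambda(1-\lambda)a^2+\rho_k,$$ where $\rho_k=2(B_{k+1}-B_k)\lambda(1-\lambda)a^2$ if $B_k\le B_{k+1}$ and $\rho_k=2(B_k-B_{k+1})m_0(1-\lambda)a^2$ if $B_{k+1}<B_k$. **Proposition.** Let $\alpha\ge\frac12$, let $n\ge5$ with $n\equiv1\pmod 4$, let $\frac{d_0}{\lambda_{n+4}}\le a\le\frac{d_0}{\lambda_n}$, and let $k\ge2$ be even. If $n\ge61$, then for all $\lambda\in[\frac12,1]$: (1) if $\lambda_k\le\frac14\lambda_n$, then $$f_{k,a}(\lambda)\le f_{k,a}(1)=B_k\Big(a-\frac{1-b}{d}\lambda_ka^2\Big)^2+B_{k+1}\Big(a-\frac{1-b}{d}\lambda_{k+1}a^2\Big)^2;$$ (2) if $\frac14\lambda_n<\lambda_k\le\lambda_n$,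 then $$f_{k,a}(\lambda)\le f_{k,a}(1)=B_k\Big(ba+(1-b)\frac{d}{4\lambda_k}\Big)^2+B_{k+1}\Big(ba+(1-b)\frac{d}{4\lambda_{k+1}}\Big)^2.$$ If $5\le n\le65$, then for all $\lambda\in[\frac12,1]$: (1) if $\lambda_k\le\frac14\lambda_n$, then $$f_{k,a}(\lambda)\le B_k\Big(a-\frac{1-b}{d}\lambda_ka^2\Big)^2+B_{k+1}\Big(a-\frac{1-b}{d}\lambda_{k+1}a^2\Big)^2+\frac12(B_k+B_{k+1})c_ka^2;$$ (2) if $\frac14\lambda_n<\lambda_k\le\lambda_n$, then $$f_{k,a}(\lambda)\le B_k\Big(ba+(1-b)\frac{d}{4\lambda_k}\Big)^2+B_{k+1}\Big(ba+(1-b)\frac{d}{4\lambda_{k+1}}\Big)^2+\frac12(B_k+B_{k+1})c_ka^2.$$ -/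

import Mathlib

open Polynomial

noncomputable section

namespace S6

/-- The Gegenbauer polynomials `C_k^ν`, given by the standard three-term recurrence
`(k + 2) C_{k+2}^ν = 2 (k + 1 + ν) x C_{k+1}^ν - (k + 2 ν) C_k^ν`,
with `C_0^ν = 1` and `C_1^ν = 2 ν x`. -/
def gegenbauer (ν : ℝ) : ℕ → ℝ[X]
  | 0 => 1
  | 1 => C (2 * ν) * X
  | k + 2 =>
      C (2 * ((k : ℝ) + 1 + ν) / ((k : ℝ) + 2)) * X * gegenbauer ν (k + 1)
        - C (((k : ℝ) + 2 * ν) / ((k : ℝ) + 2)) * gegenbauer ν k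

/-- The multiple `F_k^ν = k! Γ(2ν) / Γ(k + 2ν) C_k^ν` of `C_k^ν`, normalized by `F_k^ν(1) = 1`. -/
def normGegenbauer (ν : ℝ) (k : ℕ) : ℝ[X] :=
  C ((k.factorial : ℝ) * Real.Gamma (2 * ν) / Real.Gamma ((k : ℝ) + 2 * ν)) * gegenbauer ν k

/-- `λ_k = k (k + 5)`. -/
def lam (k : ℕ) : ℝ := (k : ℝ) * ((k : ℝ) + 5)

/-- `F̃_k' = (6 / λ_k) F_k'`, where `F_k = F_k^{5/2}`. -/
def tildeF' (k : ℕ) : ℝ[X] := C (6 / lam k) * derivative (normGegenbauer (5 / 2) k)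

/-- `c_k = max_{0 ≤ x ≤ 1} |F̃_{k+1}'(x) - F̃_k'(x)|`. -/
def c (k : ℕ) : ℝ :=
  sSup ((fun x : ℝ => |(tildeF' (k + 1)).eval x - (tildeF' k).eval x|) '' Set.Icc 0 1)

/-- The supremum in the definition of `c k` is a maximum. -/
theorem isGreatest_c (k : ℕ) :
    IsGreatest ((fun x : ℝ => |(tildeF' (k + 1)).eval x - (tildeF' k).eval x|) '' Set.Icc 0 1)
      (c k) := by
  have hc : IsCompact
      ((fun x : ℝ => |(tildeF' (k + 1)).eval x - (tildeF' k).eval x|) '' Set.Icc 0 1) :=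
    isCompact_Icc.image (by fun_prop)
  exact hc.isGreatest_sSup ((Set.nonempty_Icc.2 zero_le_one).image _)

/-- The constant `d = 8`. -/
def d : ℝ := 8

/-- The constant `b = 0.33`. -/
def b : ℝ := 33 / 100

/-- The constant `d_0 = 16`. -/
def d₀ : ℝ := 16

/-- The constant `m_0 = 0.04`. -/
def m₀ : ℝ := 4 / 100

/-- `B_k = (9 α² / 32) (λ_{n+1} - λ_k + 11 / (7 α)) (2 k + 5)`. -/
def B (n : ℕ) (α : ℝ) (k : ℕ) : ℝ :=
  9 * α ^ 2 / 32 * (lam (n + 1) - lam k + 11 / (7 * α)) * (2 * (k : ℝ) + 5)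

open Classical in
/-- The bound `𝒜_k^+` on the half `∫_0^1 (1 - x²) F̃_k' g`, as a function of `a_+`
(used for `λ_k ≤ λ_n`). -/
def Aplus (n k : ℕ) (ap : ℝ) : ℝ :=
  if lam k ≤ lam n / 4 then ap - (1 - b) / d * lam k * ap ^ 2
  else b * ap + (1 - b) * (d / (4 * lam k))

open Classical in
/-- The bound `𝒜_k^-` on the half `∫_{-1}^0 (1 - x²) F̃_k' g`, as a function of `a_-`.
The two cases meet at `a_- = d / (2 λ_k) = 4 / λ_k`. -/
def Aminus (k : ℕ) (am : ℝ) : ℝ :=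
  if am ≤ 4 / lam k then am - (1 - b) / d * lam k * am ^ 2
  else b * am + (1 - b) * (d / (4 * lam k))

open Classical in
/-- The bound on the remainder `R_{k,3}`, with `l = a_+ / a`. -/
def R₃ (n : ℕ) (α : ℝ) (k : ℕ) (a l : ℝ) : ℝ :=
  if B n α k ≤ B n α (k + 1) then 2 * (B n α (k + 1) - B n α k) * l * (1 - l) * a ^ 2
  else 2 * (B n α k - B n α (k + 1)) * m₀ * (1 - l) * a ^ 2

/-- The combined upper bound `f_{k,a}(l)`, where `l = a_+ / a`, so that `a_+ = l a` and
`a_- = (1 - l) a`. -/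
def f (n : ℕ) (α : ℝ) (k : ℕ) (a l : ℝ) : ℝ :=
  B n α k * (|Aplus n k (l * a)| ^ 2 + |Aminus k ((1 - l) * a)| ^ 2)
    + B n α (k + 1) * (|Aplus n (k + 1) (l * a)| ^ 2 + |Aminus (k + 1) ((1 - l) * a)| ^ 2)
    + 2 * (B n α k + B n α (k + 1)) * c k * l * (1 - l) * a ^ 2
    + R₃ n α k a l

end S6

end

/-!
# The combined bound `f n α k a l` is controlled by its value at `l = 1`

Put `m = 1 - l`. Passing from `l = 1` to `l` splits `a` into `a₊ = l a` and `a₋ = m a`; the squares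
`|𝒜_k⁺|² + |𝒜_k⁻|²` drop by at least `2 l m κ a²` for an explicit constant `κ > 0`. The remaining
terms of `f` are also at most multiples of `l m a²` (for `l ≥ 1 / 2` one has `m ≤ 2 l m`), so that
everything reduces to an inequality between weights, `f_le_of_gains`: the weighted mean of the gains
at `k` and `k + 1` has to exceed `c k` plus the relative variation of the weights `B`. When a term
with `c k` is allowed on the right-hand side, `2 l m ≤ 1 / 2` disposes of `c k`, and the gains only
have to exceed the variation of the weights.

*Gains.* If `λ_k ≤ λ_n / 4`, both bounds are quadratic and `gain_first` is elementary. Otherwise the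
gain depends on `τ = λ_k a`; for fixed `m τ` it suffices to look at an extreme value of `τ`
(`gain_of_le`), and the remaining one-variable polynomial inequality gives `κ = 0.0274` in all
cases and more for `τ ≤ 5` or `τ ≥ 8` (`GainConst`).

*The constants `c k`.* For large `n` the gain in the second regime leaves room for little more than
the true size of `c k`, so a nearly sharp bound is needed. With `z = (1 - x) / 2`, `j = k - 1` and
`N = k + 3`, the difference of consecutive normalized Gegenbauer polynomials is a Jacobi polynomial:
`F̃_{k+1}'(x) - F̃_k'(x) = -(N / 2) z ₂F₁(-j, j + 8; 5; z)` (`tildeF'_sub_eval`). For `N² z ≤ 6` the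
hypergeometric series alternates with decreasing terms and is bounded by its partial sums. For
`N² z ≥ 6` the hypergeometric equation makes a Sonin function of `y = z^{3/2} (1 - z) ₂F₁` decrease
up to `z = 1 / 2` (`sonin_le`), so that `z ₂F₁` is bounded by the data at `N² z = 6`, which is past
its first and largest extremum. This gives `c k ≤ 4 / (k + 3)` in general (`c_le_four`) and
`c k ≤ 0.88 / (k + 3)` for `k ≥ 30` (`c_le_of_thirty_le`).

*Weights.* With `n ≥ 61` and `λ_k > λ_n / 4` one has `k ≥ 30`. For `k ≥ 36` the inequality between
the weights follows from polynomial estimates in `k`; for `k = 30, 32, 34` only six pairs `(k, n)`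
are left, and for these the improved gains for small `τ` are needed.
-/

namespace S6

/-! ### Terminating hypergeometric polynomials -/

/-- The rising factorial `(a)_i = a (a + 1) ⋯ (a + i - 1)`. -/
noncomputable def rising (a : ℝ) (i : ℕ) : ℝ := ∏ r ∈ Finset.range i, (a + r)

@[simp] theorem rising_zero (a : ℝ) : rising a 0 = 1 := by simp [rising]

theorem rising_succ (a : ℝ) (i : ℕ) : rising a (i + 1) = rising a i * (a + i) := by
  simp [rising, Finset.prod_range_succ]

theorem rising_succ' (a : ℝ) (i : ℕ) : rising a (i + 1) = a * rising (a + 1) i := by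
  simp only [rising, Finset.prod_range_succ', Nat.cast_zero, add_zero]
  rw [mul_comm]
  congr 1
  refine Finset.prod_congr rfl fun r _ => ?_
  push_cast
  ring

theorem rising_pos {a : ℝ} (ha : 0 < a) (i : ℕ) : 0 < rising a i :=
  Finset.prod_pos fun r _ => by positivity

theorem rising_neg_eq_zero {k i : ℕ} (h : k < i) : rising (-(k : ℝ)) i = 0 :=
  Finset.prod_eq_zero (Finset.mem_range.2 h) (by simp)

/-- The hypergeometric coefficient `(a)_i (b)_i / ((c)_i i!)`. -/
noncomputable def hypCoeff (a b c : ℝ) (i : ℕ) : ℝ :=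
  rising a i * rising b i / (rising c i * (i.factorial : ℝ))

/-- The hypergeometric polynomial `₂F₁(-k, b; c; X)`. -/
noncomputable def hypPoly (k : ℕ) (b c : ℝ) : ℝ[X] :=
  ∑ i ∈ Finset.range (k + 1), monomial i (hypCoeff (-(k : ℝ)) b c i)

theorem coeff_hypPoly (k : ℕ) (b c : ℝ) (i : ℕ) :
    (hypPoly k b c).coeff i = hypCoeff (-(k : ℝ)) b c i := by
  simp only [hypPoly, finsetSum_coeff, coeff_monomial, Finset.sum_ite_eq', Finset.mem_range]
  split_ifs with h
  · rfl
  · rw [hypCoeff, rising_neg_eq_zero (by omega)]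
    simp

theorem hypCoeff_succ (a b : ℝ) {c : ℝ} (hc : 0 < c) (i : ℕ) :
    ((i : ℝ) + 1) * (c + i) * hypCoeff a b c (i + 1) = (a + i) * (b + i) * hypCoeff a b c i := by
  have h1 := (rising_pos hc i).ne'
  have h2 : c + (i : ℝ) ≠ 0 := by positivity
  have h3 : (i.factorial : ℝ) ≠ 0 := by positivity
  simp only [hypCoeff, rising_succ, Nat.factorial_succ]
  push_cast
  field_simp

theorem derivative_hypPoly (k : ℕ) (b : ℝ) {c : ℝ} (hc : 0 < c) :
    derivative (hypPoly (k + 1) b c) = C (-((k : ℝ) + 1) * b / c) * hypPoly k (b + 1) (c + 1) := by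
  ext i
  have h1 := (rising_pos (show 0 < c + 1 by positivity) i).ne'
  have h3 : (i.factorial : ℝ) ≠ 0 := by positivity
  have h4 := hc.ne'
  simp only [coeff_derivative, coeff_C_mul, coeff_hypPoly, hypCoeff, rising_succ',
    Nat.factorial_succ]
  push_cast
  rw [show -((k : ℝ) + 1) + 1 = -k by ring]
  field_simp

/-- The hypergeometric differential equation. -/
theorem hypPoly_ode (k : ℕ) (b : ℝ) {c : ℝ} (hc : 0 < c) :
    X * (1 - X) * derivative (derivative (hypPoly k b c))
      + (C c - C (b - k + 1) * X) * derivative (hypPoly k b c)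
      + C (k * b) * hypPoly k b c = 0 := by
  have key : ∀ i : ℕ, _ := fun i => hypCoeff_succ (-(k : ℝ)) b hc i
  rw [show X * (1 - X) * derivative (derivative (hypPoly k b c))
      + (C c - C (b - k + 1) * X) * derivative (hypPoly k b c)
      + C (k * b) * hypPoly k b c
      = X * derivative (derivative (hypPoly k b c))
        - X * (X * derivative (derivative (hypPoly k b c)))
        + C c * derivative (hypPoly k b c) - C (b - k + 1) * (X * derivative (hypPoly k b c))
        + C (k * b) * hypPoly k b c by ring]
  ext i
  rcases i with _ | _ | i
  · have := key 0
    simp only [coeff_add, coeff_sub, coeff_C_mul, coeff_X_mul_zero, coeff_derivative,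
      coeff_hypPoly, coeff_zero] at this ⊢
    push_cast at this ⊢
    linear_combination this
  · have := key 1
    simp only [coeff_add, coeff_sub, coeff_C_mul, coeff_X_mul, coeff_X_mul_zero,
      coeff_derivative, coeff_hypPoly, coeff_zero, zero_add] at this ⊢
    push_cast at this ⊢
    linear_combination this
  · have := key (i + 2)
    simp only [coeff_add, coeff_sub, coeff_C_mul, coeff_X_mul,
      coeff_derivative, coeff_hypPoly, coeff_zero] at this ⊢
    push_cast at this ⊢
    linear_combination this

/-! ### Gegenbauer polynomials as hypergeometric polynomials -/

/-- The three-term recurrence of the normalized Gegenbauer polynomials `F_k^{5/2}`, in the variable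
`z = (1 - x) / 2`. -/
theorem hypPoly_recurrence (k : ℕ) :
    C ((k : ℝ) + 6) * hypPoly (k + 2) (k + 7) 3 =
      C (2 * (k : ℝ) + 7) * ((1 - 2 * X) * hypPoly (k + 1) (k + 6) 3)
        - C ((k : ℝ) + 1) * hypPoly k (k + 5) 3 := by
  rw [show (1 - 2 * X) * hypPoly (k + 1) (k + 6) 3
    = hypPoly (k + 1) (k + 6) 3 - C 2 * (X * hypPoly (k + 1) (k + 6) 3) by
      rw [show (C 2 : ℝ[X]) = 2 from rfl]; ring]
  ext i
  rcases i with _ | _ | i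
  · simp [coeff_hypPoly, hypCoeff]
    ring
  · simp only [coeff_sub, coeff_C_mul, coeff_X_mul, coeff_hypPoly, hypCoeff, rising_succ]
    simp
    ring
  · simp only [coeff_sub, coeff_C_mul, coeff_X_mul, coeff_hypPoly, hypCoeff]
    have e1 : rising (-((k + 2 : ℕ) : ℝ)) (i + 2) =
        (-(k : ℝ) - 2) * ((-(k : ℝ) - 1) * rising (-(k : ℝ)) i) := by
      rw [rising_succ', rising_succ']; push_cast
      rw [show -((k : ℝ) + 2) + 1 + 1 = -k by ring]; ring
    have e2 : rising (-((k + 1 : ℕ) : ℝ)) (i + 2) =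
        (-(k : ℝ) - 1) * (rising (-(k : ℝ)) i * (-k + i)) := by
      rw [rising_succ', rising_succ]; push_cast
      rw [show -((k : ℝ) + 1) + 1 = -k by ring]; ring
    have e3 : rising (-((k + 1 : ℕ) : ℝ)) (i + 1) = (-(k : ℝ) - 1) * rising (-(k : ℝ)) i := by
      rw [rising_succ']; push_cast
      rw [show -((k : ℝ) + 1) + 1 = -k by ring]; ring
    have e4 : rising (-(k : ℝ)) (i + 2) = rising (-(k : ℝ)) i * (-k + i) * (-k + i + 1) := by
      rw [rising_succ, rising_succ]; push_cast; ring
    have f1 : rising ((k : ℝ) + 7) (i + 2)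
        = rising ((k : ℝ) + 7) i * (k + 7 + i) * (k + 8 + i) := by
      rw [rising_succ, rising_succ]; push_cast; ring
    have f2 : rising ((k : ℝ) + 6) (i + 2)
        = (k + 6) * (rising ((k : ℝ) + 7) i * (k + 7 + i)) := by
      rw [rising_succ', rising_succ, show (k : ℝ) + 6 + 1 = k + 7 by ring]
    have f3 : rising ((k : ℝ) + 6) (i + 1) = (k + 6) * rising ((k : ℝ) + 7) i := by
      rw [rising_succ', show (k : ℝ) + 6 + 1 = k + 7 by ring]
    have f4 : rising ((k : ℝ) + 5) (i + 2) = (k + 5) * ((k + 6) * rising ((k : ℝ) + 7) i) := by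
      rw [rising_succ', rising_succ', show (k : ℝ) + 5 + 1 = k + 6 by ring,
        show (k : ℝ) + 6 + 1 = k + 7 by ring]
    have h1 := (rising_pos (show (0 : ℝ) < 3 by norm_num) i).ne'
    have h3 : (i.factorial : ℝ) ≠ 0 := by positivity
    have h4 : (3 : ℝ) + i ≠ 0 := by positivity
    have h5 : (3 : ℝ) + (i + 1) ≠ 0 := by positivity
    rw [e1, e2, e3, e4, f1, f2, f3, f4]
    simp only [rising_succ 3, Nat.factorial_succ]
    push_cast
    field_simp
    ring

theorem gegenbauer_eval (k : ℕ) (z : ℝ) :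
    (gegenbauer (5 / 2) k).eval (1 - 2 * z) =
      ((k : ℝ) + 1) * (k + 2) * (k + 3) * (k + 4) / 24 * (hypPoly k (k + 5) 3).eval z := by
  induction k using Nat.twoStepInduction with
  | zero => simp [gegenbauer, hypPoly, hypCoeff]; norm_num
  | one =>
    simp [gegenbauer, hypPoly, hypCoeff, Finset.sum_range_succ, rising_succ]
    ring
  | more k h0 h1 =>
    have hr := congrArg (eval z) (hypPoly_recurrence k)
    simp only [eval_mul, eval_sub, eval_C, eval_one, eval_X, eval_ofNat] at hr
    have e1 : (((k + 1 : ℕ) : ℝ) + 5) = k + 6 := by push_cast; ring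
    have e2 : (((k + 2 : ℕ) : ℝ) + 5) = k + 7 := by push_cast; ring
    rw [e1] at h1
    rw [e2, gegenbauer]
    simp only [eval_mul, eval_sub, eval_C, eval_X]
    rw [h0, h1]
    have h6 : (k : ℝ) + 6 ≠ 0 := by positivity
    have h2 : (k : ℝ) + 2 ≠ 0 := by positivity
    have hr' : (hypPoly (k + 2) (k + 7) 3).eval z =
        ((2 * (k : ℝ) + 7) * ((1 - 2 * z) * (hypPoly (k + 1) (k + 6) 3).eval z)
          - (k + 1) * (hypPoly k (k + 5) 3).eval z) / (k + 6) := by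
      rw [eq_div_iff h6]; linarith
    rw [hr']
    push_cast
    field_simp
    ring

/-- `F_k^{5/2}(x) = ₂F₁(-k, k + 5; 3; (1 - x) / 2)`. -/
theorem normGegenbauer_eq (k : ℕ) :
    normGegenbauer (5 / 2) k = (hypPoly k (k + 5) 3).comp (C (1 / 2) * (1 - X)) := by
  refine Polynomial.funext fun x => ?_
  have h := gegenbauer_eval k ((1 - x) / 2)
  rw [show 1 - 2 * ((1 - x) / 2) = x by ring] at h
  have g5 : Real.Gamma (2 * (5 / 2)) = 24 := by
    rw [show (2 : ℝ) * (5 / 2) = (4 : ℕ) + 1 by norm_num, Real.Gamma_nat_eq_factorial]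
    norm_num [Nat.factorial]
  have gk : Real.Gamma ((k : ℝ) + 2 * (5 / 2)) =
      ((k : ℝ) + 4) * (k + 3) * (k + 2) * (k + 1) * k.factorial := by
    rw [show (k : ℝ) + 2 * (5 / 2) = (k + 4 : ℕ) + 1 by push_cast; ring,
      Real.Gamma_nat_eq_factorial]
    simp only [Nat.factorial_succ]
    push_cast
    ring
  have h3 : (k.factorial : ℝ) ≠ 0 := by positivity
  simp only [normGegenbauer, eval_mul, eval_C, eval_comp, eval_sub, eval_one, eval_X]
  rw [h, g5, gk, show 1 / 2 * (1 - x) = (1 - x) / 2 by ring]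
  field_simp

/-- `F̃_{j+1}'(x) = ₂F₁(-j, j + 7; 4; (1 - x) / 2)`. -/
theorem tildeF'_succ_eval (j : ℕ) (x : ℝ) :
    (tildeF' (j + 1)).eval x = (hypPoly j (j + 7) 4).eval ((1 - x) / 2) := by
  have hd := derivative_hypPoly j ((j : ℝ) + 6) (show (0 : ℝ) < 3 by norm_num)
  have e : (((j + 1 : ℕ) : ℝ) + 5) = j + 6 := by push_cast; ring
  rw [tildeF', normGegenbauer_eq, derivative_comp, e, hd]
  have h1 : (j : ℝ) + 1 ≠ 0 := by positivity
  have h2 : (j : ℝ) + 6 ≠ 0 := by positivity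
  simp only [lam, eval_mul, eval_C, eval_comp, eval_sub, eval_one, eval_X, derivative_mul,
    derivative_C, derivative_sub, derivative_one, derivative_X, eval_add, eval_zero]
  rw [show (j : ℝ) + 6 + 1 = j + 7 by ring, show (3 : ℝ) + 1 = 4 by norm_num,
    show 1 / 2 * (1 - x) = (1 - x) / 2 by ring]
  push_cast
  rw [show (j : ℝ) + 1 + 5 = j + 6 by ring]
  field_simp
  ring

/-- Consecutive normalized Gegenbauer polynomials of index `7/2` differ by a Jacobi polynomial
times `z = (1 - x) / 2`. -/
theorem hypPoly_sub (j : ℕ) :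
    hypPoly (j + 1) (j + 8) 4 - hypPoly j (j + 7) 4 =
      C (-((j : ℝ) + 4) / 2) * (X * hypPoly j (j + 8) 5) := by
  ext i
  rcases i with _ | i
  · simp [coeff_hypPoly, hypCoeff]
  · simp only [coeff_sub, coeff_C_mul, coeff_X_mul, coeff_hypPoly, hypCoeff]
    have e1 : rising (-((j + 1 : ℕ) : ℝ)) (i + 1) = (-(j : ℝ) - 1) * rising (-(j : ℝ)) i := by
      rw [rising_succ']; push_cast
      rw [show -((j : ℝ) + 1) + 1 = -j by ring]; ring
    have f1 : rising ((j : ℝ) + 7) (i + 1) = (j + 7) * rising ((j : ℝ) + 8) i := by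
      rw [rising_succ', show (j : ℝ) + 7 + 1 = j + 8 by ring]
    have f2 : rising (4 : ℝ) (i + 1) = 4 * rising (5 : ℝ) i := by
      rw [rising_succ', show (4 : ℝ) + 1 = 5 by norm_num]
    have h1 := (rising_pos (show (0 : ℝ) < 5 by norm_num) i).ne'
    have h3 : (i.factorial : ℝ) ≠ 0 := by positivity
    rw [e1, f1, f2, rising_succ (-(j : ℝ)), rising_succ ((j : ℝ) + 8)]
    simp only [Nat.factorial_succ]
    push_cast
    field_simp
    ring

theorem tildeF'_sub_eval (j : ℕ) (x : ℝ) :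
    (tildeF' (j + 2)).eval x - (tildeF' (j + 1)).eval x =
      -((j : ℝ) + 4) / 2 * ((1 - x) / 2 * (hypPoly j (j + 8) 5).eval ((1 - x) / 2)) := by
  have h := congrArg (eval ((1 - x) / 2)) (hypPoly_sub j)
  simp only [eval_mul, eval_sub, eval_C, eval_X] at h
  rw [tildeF'_succ_eval, tildeF'_succ_eval, ← h]
  push_cast
  rw [show (j : ℝ) + 1 + 7 = j + 8 by ring]

/-! ### Alternating series bounds -/

theorem alternating_sum_mem_Icc {u : ℕ → ℝ} (h0 : ∀ i, 0 ≤ u i) (ha : ∀ i, u (i + 1) ≤ u i)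
    (n : ℕ) : ∑ i ∈ Finset.range n, (-1) ^ i * u i ∈ Set.Icc 0 (u 0) := by
  induction n generalizing u with
  | zero => simpa using h0 0
  | succ n ih =>
    have h := ih (u := fun i => u (i + 1)) (fun i => h0 _) (fun i => ha _)
    have e : ∑ i ∈ Finset.range n, (-1 : ℝ) ^ (i + 1) * u (i + 1) =
        -∑ i ∈ Finset.range n, (-1) ^ i * u (i + 1) := by
      rw [← Finset.sum_neg_distrib]
      exact Finset.sum_congr rfl fun i _ => by ring
    rw [Finset.sum_range_succ', e]
    have := ha 0
    simp only [Set.mem_Icc, zero_add] at h this ⊢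
    constructor <;> linarith [h.1, h.2]

/-- A polynomial whose terms at `z` alternate in sign and decrease from the linear one on lies
between two consecutive partial sums. -/
theorem eval_mem_Icc_of_alternating {p : ℝ[X]} {z : ℝ} {u : ℕ → ℝ}
    (hu : ∀ i, p.coeff i * z ^ i = (-1) ^ i * u i) (h0 : ∀ i, 0 ≤ u i)
    (ha : ∀ i, 1 ≤ i → u (i + 1) ≤ u i) :
    p.eval z ∈ Set.Icc (u 0 - u 1 + u 2 - u 3) (u 0 - u 1 + u 2 - u 3 + u 4) := by
  have h := alternating_sum_mem_Icc (u := fun i => u (i + 4)) (fun i => h0 _)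
    (fun i => ha _ (by omega)) (p.natDegree + 1)
  have e : p.eval z = u 0 - u 1 + u 2 - u 3
      + ∑ i ∈ Finset.range (p.natDegree + 1), (-1) ^ i * u (i + 4) := by
    rw [eval_eq_sum_range' (n := p.natDegree + 1 + 4) (by omega), Finset.sum_congr rfl
      fun i _ => hu i]
    simp only [Finset.sum_range_succ' _ (p.natDegree + 1 + 3),
      Finset.sum_range_succ' _ (p.natDegree + 1 + 2),
      Finset.sum_range_succ' _ (p.natDegree + 1 + 1), Finset.sum_range_succ' _ (p.natDegree + 1)]
    have e' : ∑ i ∈ Finset.range (p.natDegree + 1), (-1 : ℝ) ^ (i + 1 + 1 + 1 + 1)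
        * u (i + 1 + 1 + 1 + 1)
        = ∑ i ∈ Finset.range (p.natDegree + 1), (-1) ^ i * u (i + 4) :=
      Finset.sum_congr rfl fun i _ => by ring
    rw [e']
    ring
  simp only [Set.mem_Icc, zero_add] at h ⊢
  constructor <;> linarith [h.1, h.2]

/-- The absolute values of the terms of `₂F₁(-j, j + 8; 5; z)`. -/
noncomputable def jacobiTerm (j : ℕ) (z : ℝ) (i : ℕ) : ℝ :=
  (-1) ^ i * hypCoeff (-(j : ℝ)) (j + 8) 5 i * z ^ i

theorem jacobiTerm_zero (j : ℕ) (z : ℝ) : jacobiTerm j z 0 = 1 := by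
  simp [jacobiTerm, hypCoeff]

theorem jacobiTerm_succ (j : ℕ) (z : ℝ) (i : ℕ) :
    jacobiTerm j z (i + 1) =
      jacobiTerm j z i * ((((j : ℝ) + 4) ^ 2 - (4 + i) ^ 2) * z) / ((5 + i) * (i + 1)) := by
  have h := hypCoeff_succ (-(j : ℝ)) (j + 8) (show (0 : ℝ) < 5 by norm_num) i
  have h1 : ((5 : ℝ) + i) * (i + 1) ≠ 0 := by positivity
  rw [eq_div_iff h1]
  simp only [jacobiTerm, pow_succ]
  linear_combination (-(-1 : ℝ) ^ i * z ^ i * z) * h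

theorem jacobiTerm_nonneg (j : ℕ) {z : ℝ} (hz : 0 ≤ z) (i : ℕ) : 0 ≤ jacobiTerm j z i := by
  suffices h : 0 ≤ jacobiTerm j z i ∧ (j < i → jacobiTerm j z i = 0) from h.1
  induction i with
  | zero => simp [jacobiTerm_zero]
  | succ i ih =>
    rw [jacobiTerm_succ]
    rcases lt_trichotomy i j with hij | rfl | hij
    · have : (i : ℝ) ≤ j := by exact_mod_cast hij.le
      have h2 : 0 ≤ ((j : ℝ) + 4) ^ 2 - (4 + i) ^ 2 := by nlinarith
      have := ih.1
      exact ⟨by positivity, fun h => by omega⟩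
    · rw [show ((i : ℝ) + 4) ^ 2 - (4 + i) ^ 2 = 0 by ring]
      simp
    · rw [ih.2 hij]
      simp

theorem jacobiTerm_succ_le (j : ℕ) {z : ℝ} (hz : 0 ≤ z) (hZ : ((j : ℝ) + 4) ^ 2 * z ≤ 6) (i : ℕ) :
    ((i : ℝ) + 1) * (5 + i) * jacobiTerm j z (i + 1) ≤ 6 * jacobiTerm j z i := by
  have h1 : ((5 : ℝ) + i) * (i + 1) ≠ 0 := by positivity
  have h2 := jacobiTerm_nonneg j hz i
  rw [jacobiTerm_succ]
  have h3 : (((j : ℝ) + 4) ^ 2 - (4 + i) ^ 2) * z ≤ 6 := by nlinarith [sq_nonneg (4 + (i : ℝ))]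
  have h4 := mul_le_mul_of_nonneg_left h3 h2
  calc _ = jacobiTerm j z i * ((((j : ℝ) + 4) ^ 2 - (4 + i) ^ 2) * z) := by field_simp
    _ ≤ _ := by linarith

theorem jacobi_eval_mem (j : ℕ) {z : ℝ} (hz : 0 ≤ z) (hZ : ((j : ℝ) + 4) ^ 2 * z ≤ 6) :
    (hypPoly j (j + 8) 5).eval z ∈ Set.Icc
      (1 - jacobiTerm j z 1 + jacobiTerm j z 2 - jacobiTerm j z 3)
      (1 - jacobiTerm j z 1 + jacobiTerm j z 2 - jacobiTerm j z 3 + jacobiTerm j z 4) := by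
  rw [← jacobiTerm_zero j z]
  refine eval_mem_Icc_of_alternating (fun i => ?_) (jacobiTerm_nonneg j hz) fun i hi => ?_
  · rw [coeff_hypPoly, jacobiTerm, ← mul_assoc, ← mul_assoc, ← mul_pow]
    norm_num
  · have h := jacobiTerm_succ_le j hz hZ i
    have h0 := jacobiTerm_nonneg j hz (i + 1)
    have h1 := jacobiTerm_nonneg j hz i
    have : (1 : ℝ) ≤ i := by exact_mod_cast hi
    have h12 : 12 ≤ ((i : ℝ) + 1) * (5 + i) := by nlinarith
    nlinarith [mul_le_mul_of_nonneg_right h12 h0]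

theorem jacobi_derivative_mem (j : ℕ) {z : ℝ} (hz : 0 ≤ z) (hZ : ((j : ℝ) + 4) ^ 2 * z ≤ 6) :
    z * (derivative (hypPoly j (j + 8) 5)).eval z ∈ Set.Icc
      (-jacobiTerm j z 1 + 2 * jacobiTerm j z 2 - 3 * jacobiTerm j z 3)
      (-jacobiTerm j z 1 + 2 * jacobiTerm j z 2 - 3 * jacobiTerm j z 3
        + 4 * jacobiTerm j z 4) := by
  have h := eval_mem_Icc_of_alternating (p := X * derivative (hypPoly j (j + 8) 5)) (z := z)
    (u := fun i => i * jacobiTerm j z i) (fun i => ?_)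
    (fun i => mul_nonneg i.cast_nonneg (jacobiTerm_nonneg j hz i)) fun i hi => ?_
  · simpa using h
  · rcases i with _ | i
    · simp
    · rw [coeff_X_mul, coeff_derivative, coeff_hypPoly, jacobiTerm]
      have : ((-1 : ℝ) ^ (i + 1)) * (-1) ^ (i + 1) = 1 := by rw [← mul_pow]; norm_num
      push_cast
      linear_combination (-(hypCoeff (-(j : ℝ)) (j + 8) 5 (i + 1) * ((i : ℝ) + 1)
        * z ^ (i + 1))) * this
  · have h := jacobiTerm_succ_le j hz hZ i
    have h0 := jacobiTerm_nonneg j hz (i + 1)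
    have h1 := jacobiTerm_nonneg j hz i
    have : (1 : ℝ) ≤ i := by exact_mod_cast hi
    push_cast
    nlinarith [mul_nonneg h0 (show (0 : ℝ) ≤ i by linarith)]

/-! ### A Sonin function -/

/-- The denominator of the Sonin function: `z² (1 - z)²` times the coefficient of `y` in the
equation of `y = z^{3/2} (1 - z) ₂F₁(-j, j + 8; 5; z)`, with `n = j + 4`. -/
noncomputable def soninDen (n z : ℝ) : ℝ :=
  (n ^ 2 - 8) * z * (1 - z) - 15 / 4 * (1 - z) ^ 2 - 2 * z ^ 2

/-- The Sonin function `y² + y'² / Q` of `y = z^{3/2} (1 - z) p(z)`, where `y'' + P y' + Q y = 0`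
if `p = ₂F₁(-j, j + 8; 5; z)` and `n = j + 4`. -/
noncomputable def sonin (n : ℝ) (p : ℝ[X]) (z : ℝ) : ℝ :=
  z ^ 3 * (1 - z) ^ 2 * (p.eval z ^ 2
    + ((3 - 5 * z) / 2 * p.eval z + z * (1 - z) * (derivative p).eval z) ^ 2 / soninDen n z)

theorem soninDen_pos {n z : ℝ} (hn : 5 ≤ n) (hz : 6 ≤ n ^ 2 * z) (hz0 : 0 < z) (hz2 : z ≤ 1 / 2) :
    0 < soninDen n z := by
  -- `n² ≥ 25` gives `(n² - 8) z ≥ 17 / 25 * n² z`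
  have h1 : 408 / 100 ≤ (n ^ 2 - 8) * z := by
    nlinarith [mul_nonneg hz0.le (show 0 ≤ n ^ 2 - 25 by nlinarith)]
  have h2 : 0 < 1 - z := by linarith
  have := mul_le_mul_of_nonneg_right h1 h2.le
  unfold soninDen
  nlinarith

theorem hasDerivAt_sonin {n : ℝ} {p : ℝ[X]} {z : ℝ} (hq : soninDen n z ≠ 0)
    (ode : z * (1 - z) * (derivative (derivative p)).eval z
      + (5 - 9 * z) * (derivative p).eval z + (n ^ 2 - 16) * p.eval z = 0) :
    HasDerivAt (sonin n p)
      (-(z ^ 2 * (1 - z) * ((3 - 5 * z) / 2 * p.eval z + z * (1 - z) * (derivative p).eval z) ^ 2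
        * (3 * (n ^ 2 - 8) * (1 - 2 * z) * z * (1 - z) - 15 / 2 * (1 - z) ^ 3
          + 15 * (1 - z) ^ 2 * z - 8 * (1 - z) * z ^ 2 + 4 * z ^ 3)) / soninDen n z ^ 2) z := by
  have hp := p.hasDerivAt z
  have hp' := (derivative p).hasDerivAt z
  have hid := hasDerivAt_id z
  have h1 : HasDerivAt (fun z : ℝ => 1 - z) (-1) z := by simpa using hid.const_sub 1
  have hden : HasDerivAt (soninDen n)
      ((n ^ 2 - 8) * (1 - 2 * z) + 15 / 2 * (1 - z) - 4 * z) z := by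
    have := (((hid.const_mul (n ^ 2 - 8)).mul h1).sub ((h1.pow 2).const_mul (15 / 4))).sub
      ((hid.pow 2).const_mul 2)
    refine this.congr_deriv ?_
    simp
    ring
  have h3 : HasDerivAt (fun z : ℝ => (3 - 5 * z) / 2) (-5 / 2) z := by
    have := ((hid.const_mul 5).const_sub 3).div_const 2
    refine this.congr_deriv ?_
    simp
  have hw := (h3.mul hp).add ((hid.mul h1).mul hp')
  have hall := ((hid.pow 3).mul (h1.pow 2)).mul ((hp.pow 2).add ((hw.pow 2).div hden hq))
  refine hall.congr_deriv ?_
  simp only [Pi.add_apply, Pi.mul_apply, Pi.pow_apply, id, Pi.div_apply]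
  generalize (derivative (derivative p)).eval z = c at ode ⊢
  generalize (derivative p).eval z = b at ode ⊢
  generalize p.eval z = a at ode ⊢
  have hQ : soninDen n z = (n ^ 2 - 8) * z * (1 - z) - 15 / 4 * (1 - z) ^ 2 - 2 * z ^ 2 := rfl
  generalize soninDen n z = q at hq hQ ⊢
  have hc : z * (1 - z) * c = -(5 - 9 * z) * b - (n ^ 2 - 16) * a := by linarith
  field_simp
  norm_num only [Nat.cast_ofNat, pow_one]
  subst hQ
  linear_combination 8 * z ^ 3 * (1 - z) ^ 2 * ((n ^ 2 - 8) * z * (1 - z) - 15 / 4 * (1 - z) ^ 2 - 2 * z ^ 2)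
    * (a * (3 - z * 5) + z * (1 - z) * 2 * b) * hc

/-- On `[6 / n², 1 / 2]` the Sonin function is largest at the left end point. -/
theorem sonin_le {n : ℝ} {p : ℝ[X]} (hn : 5 ≤ n)
    (ode : ∀ z : ℝ, z * (1 - z) * (derivative (derivative p)).eval z
      + (5 - 9 * z) * (derivative p).eval z + (n ^ 2 - 16) * p.eval z = 0)
    {z : ℝ} (hz : 6 / n ^ 2 ≤ z) (hz2 : z ≤ 1 / 2) :
    sonin n p z ≤ sonin n p (6 / n ^ 2) := by
  have hn2 : 0 < n ^ 2 := by positivity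
  have h0 : ∀ x : ℝ, 6 / n ^ 2 ≤ x → 0 < x ∧ 6 ≤ n ^ 2 * x := fun x hx =>
    ⟨lt_of_lt_of_le (by positivity) hx, by rwa [div_le_iff₀' hn2] at hx⟩
  have hd : ∀ x ∈ Set.Icc (6 / n ^ 2) (1 / 2), _ := fun x hx =>
    hasDerivAt_sonin (soninDen_pos hn (h0 x hx.1).2 (h0 x hx.1).1 hx.2).ne' (ode x)
  refine antitoneOn_of_deriv_nonpos (convex_Icc (6 / n ^ 2) (1 / 2))
    (fun x hx => (hd x hx).continuousAt.continuousWithinAt)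
    (fun x hx => (hd x (interior_subset hx)).differentiableAt.differentiableWithinAt)
    (fun x hx => ?_) ⟨le_rfl, hz.trans hz2⟩ ⟨hz, hz2⟩ hz
  have hx' := interior_subset hx
  obtain ⟨hx0, hx6⟩ := h0 x hx'.1
  have hx1 : x ≤ 1 / 2 := hx'.2
  rw [(hd x hx').deriv]
  have h1 : 408 / 100 ≤ (n ^ 2 - 8) * x := by
    nlinarith [mul_nonneg hx0.le (show 0 ≤ n ^ 2 - 25 by nlinarith)]
  have h2 : 0 < 1 - x := by linarith
  have h3 : 0 ≤ (1 - 2 * x) * (1 - x) := mul_nonneg (by linarith) h2.le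
  have h4 := mul_le_mul_of_nonneg_right h1 h3
  have h5 : 0 ≤ 3 * (n ^ 2 - 8) * (1 - 2 * x) * x * (1 - x) - 15 / 2 * (1 - x) ^ 3
      + 15 * (1 - x) ^ 2 * x - 8 * (1 - x) * x ^ 2 + 4 * x ^ 3 := by
    nlinarith [mul_nonneg h3 hx0.le, mul_nonneg hx0.le hx0.le, mul_nonneg h2.le h3,
      mul_nonneg (mul_nonneg hx0.le hx0.le) hx0.le]
  rw [neg_div]
  have : 0 ≤ x ^ 2 * (1 - x) := by positivity
  have := mul_nonneg (mul_nonneg this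
    (sq_nonneg ((3 - 5 * x) / 2 * p.eval x + x * (1 - x) * (derivative p).eval x))) h5
  linarith [div_nonneg this (sq_nonneg (soninDen n x))]

theorem hypPoly_ode_eval (j : ℕ) (z : ℝ) :
    z * (1 - z) * (derivative (derivative (hypPoly j (j + 8) 5))).eval z
      + (5 - 9 * z) * (derivative (hypPoly j (j + 8) 5)).eval z
      + (((j : ℝ) + 4) ^ 2 - 16) * (hypPoly j (j + 8) 5).eval z = 0 := by
  have h := congrArg (eval z) (hypPoly_ode j ((j : ℝ) + 8) (show (0 : ℝ) < 5 by norm_num))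
  simp only [eval_add, eval_mul, eval_sub, eval_one, eval_X, eval_C, eval_zero] at h
  linear_combination h

/-- Beyond `z₁ = 6 / (j + 4)²` the Sonin function controls `z ₂F₁(-j, j + 8; 5; z)` by the data at
`z₁`. -/
theorem sq_jacobi_le_of_sonin {j : ℕ} (hj : 3 ≤ j) {z₁ V : ℝ} (hz₁ : ((j : ℝ) + 4) ^ 2 * z₁ = 6)
    (hV : (hypPoly j (j + 8) 5).eval z₁ ^ 2 + ((3 - 5 * z₁) / 2 * (hypPoly j (j + 8) 5).eval z₁
      + z₁ * (1 - z₁) * (derivative (hypPoly j (j + 8) 5)).eval z₁) ^ 2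
        / soninDen ((j : ℝ) + 4) z₁ ≤ V)
    {z : ℝ} (hz : z₁ ≤ z) (hz2 : z ≤ 1 / 2) :
    (((j : ℝ) + 4) ^ 2 * z * (hypPoly j (j + 8) 5).eval z) ^ 2 ≤ 36 * V := by
  have hj' : (3 : ℝ) ≤ j := by exact_mod_cast hj
  set n : ℝ := (j : ℝ) + 4 with hn
  have hn7 : 7 ≤ n := by linarith
  have hn2 : 0 < n ^ 2 := by positivity
  have e1 : z₁ = 6 / n ^ 2 := by rw [eq_div_iff hn2.ne']; linarith
  have h1 : 0 < z₁ := by rw [e1]; positivity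
  have h49 : z₁ ≤ 6 / 49 := by nlinarith
  have h2 : 0 < z := by linarith
  have h3 : 0 < 1 - z := by linarith
  have hs := sonin_le (n := n) (by linarith) (hypPoly_ode_eval j) (e1 ▸ hz) hz2
  rw [← e1] at hs
  have hq : 0 < soninDen n z := soninDen_pos (by linarith) (by nlinarith) h2 hz2
  have hlow : z ^ 3 * (1 - z) ^ 2 * (hypPoly j (j + 8) 5).eval z ^ 2
      ≤ sonin n (hypPoly j (j + 8) 5) z := by
    unfold sonin
    refine mul_le_mul_of_nonneg_left ?_ (by positivity)
    have := div_nonneg (sq_nonneg ((3 - 5 * z) / 2 * (hypPoly j (j + 8) 5).eval z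
      + z * (1 - z) * (derivative (hypPoly j (j + 8) 5)).eval z)) hq.le
    linarith
  have hup : sonin n (hypPoly j (j + 8) 5) z₁ ≤ z₁ ^ 3 * (1 - z₁) ^ 2 * V := by
    unfold sonin
    exact mul_le_mul_of_nonneg_left hV (by positivity)
  have hV0 : 0 ≤ V := by
    refine le_trans ?_ hV
    have hq1 : 0 < soninDen n z₁ := soninDen_pos (by linarith) hz₁.ge h1 (by linarith)
    positivity
  -- `t (1 - t)²` is smallest at the left end point of `[z₁, 1 / 2]`
  have hw : z₁ * (1 - z₁) ^ 2 ≤ z * (1 - z) ^ 2 := by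
    have : 0 ≤ 1 - 2 * (z + z₁) + z ^ 2 + z * z₁ + z₁ ^ 2 := by nlinarith
    nlinarith [mul_nonneg (sub_nonneg.2 hz) this]
  have hpos : 0 < z * (1 - z) ^ 2 := by positivity
  have h5 : (z * (1 - z) ^ 2) * (z * (hypPoly j (j + 8) 5).eval z) ^ 2
      ≤ (z * (1 - z) ^ 2) * (z₁ ^ 2 * V) := by
    have := mul_le_mul_of_nonneg_right hw (show 0 ≤ z₁ ^ 2 * V by positivity)
    calc _ = z ^ 3 * (1 - z) ^ 2 * (hypPoly j (j + 8) 5).eval z ^ 2 := by ring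
      _ ≤ _ := hlow.trans (hs.trans hup)
      _ = z₁ * (1 - z₁) ^ 2 * (z₁ ^ 2 * V) := by ring
      _ ≤ _ := this
  have h6 := le_of_mul_le_mul_left h5 hpos
  have h7 := mul_le_mul_of_nonneg_left h6 (sq_nonneg (n ^ 2))
  calc _ = (n ^ 2) ^ 2 * (z * (hypPoly j (j + 8) 5).eval z) ^ 2 := by ring
    _ ≤ _ := h7
    _ = (n ^ 2 * z₁) ^ 2 * V := by ring
    _ = _ := by rw [hz₁]; ring

/-! ### Bounds for `c k` -/

/-- `c (j + 1)` is the maximum of `n / 2 * z * |₂F₁(-j, j + 8; 5; z)|` on `[0, 1 / 2]`, with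
`n = j + 4`. -/
theorem c_succ_le {j : ℕ} {V : ℝ}
    (hV : ∀ z : ℝ, 0 ≤ z → z ≤ 1 / 2 →
      |((j : ℝ) + 4) ^ 2 * z * (hypPoly j (j + 8) 5).eval z| ≤ 2 * V) :
    c (j + 1) ≤ V / ((j : ℝ) + 4) := by
  obtain ⟨x, hx, hxe⟩ := (isGreatest_c (j + 1)).1
  rw [← hxe]
  have h := hV ((1 - x) / 2) (by linarith [hx.2]) (by linarith [hx.1])
  have hn : 0 < (j : ℝ) + 4 := by positivity
  simp only
  rw [tildeF'_sub_eval, le_div_iff₀ hn]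
  have e : -((j : ℝ) + 4) / 2 * ((1 - x) / 2 * (hypPoly j (j + 8) 5).eval ((1 - x) / 2))
      * ((j : ℝ) + 4) = -(((j : ℝ) + 4) ^ 2 * ((1 - x) / 2)
        * (hypPoly j (j + 8) 5).eval ((1 - x) / 2)) / 2 := by ring
  rw [← abs_of_pos hn, ← abs_mul, abs_of_pos hn, e, abs_div, abs_neg, abs_of_pos (two_pos : (0 : ℝ) < 2)]
  linarith

theorem c_nonneg (k : ℕ) : 0 ≤ c k := by
  obtain ⟨x, -, hxe⟩ := (isGreatest_c k).1
  rw [← hxe]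
  exact abs_nonneg _

/-- The first terms of the series, with `Z = (j + 4)² z` and `w = (j + 4)⁻²`. -/
theorem jacobiTerm_values (j : ℕ) {z Z w : ℝ} (hZ : ((j : ℝ) + 4) ^ 2 * z = Z)
    (hw : w * ((j : ℝ) + 4) ^ 2 = 1) :
    jacobiTerm j z 1 = (1 - 16 * w) * Z / 5 ∧
    jacobiTerm j z 2 = jacobiTerm j z 1 * ((1 - 25 * w) * Z) / 12 ∧
    jacobiTerm j z 3 = jacobiTerm j z 2 * ((1 - 36 * w) * Z) / 21 ∧
    jacobiTerm j z 4 = jacobiTerm j z 3 * ((1 - 49 * w) * Z) / 32 := by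
  have key : ∀ a : ℝ, (((j : ℝ) + 4) ^ 2 - a) * z = (1 - a * w) * Z := fun a => by
    rw [← hZ]; linear_combination (a * z) * hw
  refine ⟨?_, ?_, ?_, ?_⟩ <;> rw [jacobiTerm_succ, key] <;> norm_num [jacobiTerm_zero]

/-- A crude bound, which suffices for the first regime. -/
theorem abs_jacobi_le_four {j : ℕ} (hj : 3 ≤ j) {z : ℝ} (hz : 0 ≤ z) (hz2 : z ≤ 1 / 2) :
    |((j : ℝ) + 4) ^ 2 * z * (hypPoly j (j + 8) 5).eval z| ≤ 2 * 4 := by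
  have hj' : (3 : ℝ) ≤ j := by exact_mod_cast hj
  have hn2 : 0 < ((j : ℝ) + 4) ^ 2 := by positivity
  rcases le_total (((j : ℝ) + 4) ^ 2 * z) 6 with hZ | hZ
  · obtain ⟨h1, h2⟩ := jacobi_eval_mem j hz hZ
    have a1 := jacobiTerm_succ_le j hz hZ 0
    have a2 := jacobiTerm_succ_le j hz hZ 1
    have a3 := jacobiTerm_succ_le j hz hZ 2
    have a4 := jacobiTerm_succ_le j hz hZ 3
    have n1 := jacobiTerm_nonneg j hz 1
    have n2 := jacobiTerm_nonneg j hz 2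
    have n3 := jacobiTerm_nonneg j hz 3
    norm_num [jacobiTerm_zero] at a1 a2 a3 a4
    have hZ0 : 0 ≤ ((j : ℝ) + 4) ^ 2 * z := by positivity
    have hF : |(hypPoly j (j + 8) 5).eval z| ≤ 1 := abs_le.2 ⟨by linarith, by linarith⟩
    rw [abs_mul, abs_of_nonneg hZ0]
    nlinarith [abs_nonneg ((hypPoly j (j + 8) 5).eval z)]
  · obtain ⟨z₁, hz₁⟩ : ∃ z₁, ((j : ℝ) + 4) ^ 2 * z₁ = 6 := ⟨6 / _, mul_div_cancel₀ _ hn2.ne'⟩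
    obtain ⟨w, hw⟩ : ∃ w, w * ((j : ℝ) + 4) ^ 2 = 1 := ⟨_, inv_mul_cancel₀ hn2.ne'⟩
    have hw0 : 0 < w := by by_contra hneg; nlinarith
    have hw49 : w ≤ 1 / 49 := by nlinarith
    have e1 : z₁ = 6 * w := by
      have : ((j : ℝ) + 4) ^ 2 * (z₁ - 6 * w) = 0 := by linarith
      rcases mul_eq_zero.1 this with h | h
      · exact absurd h hn2.ne'
      · linarith
    have hz1 : 0 ≤ z₁ := by linarith
    -- `36 * (16 / 9) = 8 ^ 2`
    have hV := sq_jacobi_le_of_sonin hj hz₁ (V := 16 / 9) ?_ (z := z) (by nlinarith) hz2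
    · refine abs_le.2 (abs_le_of_sq_le_sq' ?_ (by norm_num))
      linarith
    · obtain ⟨h1, h2⟩ := jacobi_eval_mem j hz1 hz₁.le
      obtain ⟨d1, d2⟩ := jacobi_derivative_mem j hz1 hz₁.le
      obtain ⟨t1, t2, t3, t4⟩ := jacobiTerm_values j hz₁ hw
      have n1 := jacobiTerm_nonneg j hz1 1
      have n2 := jacobiTerm_nonneg j hz1 2
      have n3 := jacobiTerm_nonneg j hz1 3
      have n4 := jacobiTerm_nonneg j hz1 4
      generalize jacobiTerm j z₁ 1 = a1 at *
      generalize jacobiTerm j z₁ 2 = a2 at *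
      generalize jacobiTerm j z₁ 3 = a3 at *
      generalize jacobiTerm j z₁ 4 = a4 at *
      have hq : 148 / 100 ≤ soninDen ((j : ℝ) + 4) z₁ := by
        rw [soninDen, show (((j : ℝ) + 4) ^ 2 - 8) * z₁ = 6 - 48 * w by rw [e1]; linarith, e1]
        nlinarith [mul_nonneg hw0.le (sub_nonneg.2 hw49)]
      generalize soninDen ((j : ℝ) + 4) z₁ = q at *
      generalize (hypPoly j (j + 8) 5).eval z₁ = F at *
      generalize (derivative (hypPoly j (j + 8) 5)).eval z₁ = F' at *
      have b1 : a1 ≤ 6 / 5 := by nlinarith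
      have b1' : 8 / 10 ≤ a1 := by nlinarith
      have b2 : a2 ≤ a1 / 2 := by nlinarith
      have b2' : 24 / 100 * a1 ≤ a2 := by nlinarith
      have b3 : a3 ≤ 2 / 7 * a2 := by nlinarith
      have b4 : a4 ≤ 3 / 16 * a3 := by nlinarith
      have hF0 : 0 ≤ F := by linarith
      have hF1 : F ≤ 6 / 10 := by linarith
      have hW : ((3 - 5 * z₁) / 2 * F + z₁ * (1 - z₁) * F') ^ 2 ≤ (12 / 10) ^ 2 := by
        have : -(12 / 10) ≤ z₁ * F' := by linarith
        have h' : z₁ * F' ≤ 0 := by linarith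
        have p1 := mul_nonneg hz1 hF0
        have p2 := mul_nonneg hz1 (neg_nonneg.2 h')
        have p3 := mul_nonneg (show 0 ≤ 3 - 5 * z₁ by linarith) hF0
        have p4 := mul_nonneg (show 0 ≤ 1 - z₁ by linarith) (neg_nonneg.2 h')
        refine sq_le_sq' ?_ ?_ <;> linarith only [p1, p2, p3, p4, hF0, hF1, this, h']
      have : ((3 - 5 * z₁) / 2 * F + z₁ * (1 - z₁) * F') ^ 2 / q ≤ 1 := by
        rw [div_le_one (by linarith)]
        linarith
      have : F ^ 2 ≤ (6 / 10) ^ 2 := pow_le_pow_left₀ hF0 hF1 2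
      linarith

theorem c_le_four {k : ℕ} (hk : 2 ≤ k) : c k ≤ 4 / ((k : ℝ) + 3) := by
  obtain ⟨j, rfl⟩ : ∃ j, k = j + 1 := ⟨k - 1, by omega⟩
  rw [show (((j + 1 : ℕ) : ℝ) + 3) = (j : ℝ) + 4 by push_cast; ring]
  refine c_succ_le fun z hz hz2 => ?_
  rcases (show j = 1 ∨ j = 2 ∨ 3 ≤ j by omega) with rfl | rfl | hj
  · have e : (hypPoly 1 ((1 : ℕ) + 8) 5).eval z = 1 - 9 / 5 * z := by
      simp [hypPoly, hypCoeff, Finset.sum_range_succ, rising_succ]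
      ring
    rw [e, abs_le]
    norm_num
    constructor <;> nlinarith [mul_nonneg hz (sub_nonneg.2 hz2)]
  · have e : (hypPoly 2 ((2 : ℕ) + 8) 5).eval z = 1 - 4 * z + 11 / 3 * z ^ 2 := by
      simp [hypPoly, hypCoeff, Finset.sum_range_succ, rising_succ, Nat.factorial]
      ring
    rw [e, abs_le]
    norm_num
    constructor <;> nlinarith [mul_nonneg hz hz, mul_nonneg hz (sub_nonneg.2 hz2),
      mul_nonneg (mul_nonneg hz hz) (sub_nonneg.2 hz2), mul_nonneg hz (sq_nonneg (1 - 2 * z))]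
  · exact abs_jacobi_le_four hj hz hz2

/-- The largest value is attained in this range, near `(j + 4)² z = 4.25`. -/
theorem abs_jacobi_le_of_le_six {j : ℕ} (hj : 29 ≤ j) {z : ℝ} (hz : 0 ≤ z)
    (hZ : ((j : ℝ) + 4) ^ 2 * z ≤ 6) :
    |((j : ℝ) + 4) ^ 2 * z * (hypPoly j (j + 8) 5).eval z| ≤ 2 * (88 / 100) := by
  have hj' : (29 : ℝ) ≤ j := by exact_mod_cast hj
  have hn2 : 0 < ((j : ℝ) + 4) ^ 2 := by positivity
  obtain ⟨w, hw⟩ : ∃ w, w * ((j : ℝ) + 4) ^ 2 = 1 := ⟨_, inv_mul_cancel₀ hn2.ne'⟩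
  have hw0 : 0 < w := pos_of_mul_pos_left (hw ▸ one_pos) hn2.le
  have hw1 : w ≤ 1 / 1089 := by
    have : (1089 : ℝ) ≤ ((j : ℝ) + 4) ^ 2 := by nlinarith
    nlinarith
  obtain ⟨h1, h2⟩ := jacobi_eval_mem j hz hZ
  have n1 := jacobiTerm_nonneg j hz 1
  have n2 := jacobiTerm_nonneg j hz 2
  have n3 := jacobiTerm_nonneg j hz 3
  obtain ⟨t1, t2, t3, t4⟩ := jacobiTerm_values j (z := z) rfl hw
  have hZ0 : 0 ≤ ((j : ℝ) + 4) ^ 2 * z := by positivity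
  generalize jacobiTerm j z 1 = a1 at *
  generalize jacobiTerm j z 2 = a2 at *
  generalize jacobiTerm j z 3 = a3 at *
  generalize jacobiTerm j z 4 = a4 at *
  generalize ((j : ℝ) + 4) ^ 2 * z = Z at *
  generalize (hypPoly j (j + 8) 5).eval z = F at *
  have b1 : a1 ≤ Z / 5 := by
    have := mul_nonneg hw0.le hZ0
    linarith
  have b2 : a2 ≤ a1 * Z / 12 := by
    have := mul_nonneg n1 (mul_nonneg hw0.le hZ0)
    linarith
  have b3 : a3 ≤ a2 * Z / 21 := by
    have := mul_nonneg n2 (mul_nonneg hw0.le hZ0)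
    linarith
  have b4 : a4 ≤ a3 * Z / 32 := by
    have := mul_nonneg n3 (mul_nonneg hw0.le hZ0)
    linarith
  have b3' : a3 ≤ a2 := by nlinarith
  -- The factors `1 - 16 w`, `1 - 25 w`, `1 - 36 w` are replaced by bounds at `w = 1 / 1089`,
  -- the first one only after it has been pulled out of all the terms.
  have hF : F ≤ 1 - 985 / 1000 * (Z / 5 - Z ^ 2 / 60 + 9439 / 10000 * (Z ^ 3 / 1260)
      - Z ^ 4 / 40320) := by
    have z2 : 0 ≤ Z ^ 2 := sq_nonneg Z
    have z3 : 0 ≤ Z ^ 3 := by positivity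
    have z4 : 0 ≤ Z ^ 4 := by positivity
    have f1 : (1 - 25 * w) * Z ^ 2 ≤ Z ^ 2 := by nlinarith
    have f2 : 9439 / 10000 * Z ^ 3 ≤ (1 - 25 * w) * (1 - 36 * w) * Z ^ 3 :=
      mul_le_mul_of_nonneg_right (by nlinarith) z3
    have f3 : (1 - 25 * w) * (1 - 36 * w) * (1 - 49 * w) * Z ^ 4 ≤ Z ^ 4 := by
      refine mul_le_of_le_one_left z4 (mul_le_one₀ (mul_le_one₀ ?_ ?_ ?_) ?_ ?_) <;> linarith
    have hT : 0 ≤ Z / 5 - Z ^ 2 / 60 + 9439 / 10000 * (Z ^ 3 / 1260) - Z ^ 4 / 40320 := by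
      have q1 : Z ^ 2 ≤ 6 * Z := by nlinarith
      have q2 : Z ^ 4 ≤ 6 * Z ^ 3 := by nlinarith
      linarith
    have hg := mul_le_mul (show 985 / 1000 ≤ 1 - 16 * w by linarith)
      (show Z / 5 - Z ^ 2 / 60 + 9439 / 10000 * (Z ^ 3 / 1260) - Z ^ 4 / 40320
        ≤ Z / 5 - (1 - 25 * w) * Z ^ 2 / 60 + (1 - 25 * w) * (1 - 36 * w) * Z ^ 3 / 1260
          - (1 - 25 * w) * (1 - 36 * w) * (1 - 49 * w) * Z ^ 4 / 40320 by linarith)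
      hT (by linarith)
    have e4 : 1 - a1 + a2 - a3 + a4 = 1 - (1 - 16 * w) * (Z / 5 - (1 - 25 * w) * Z ^ 2 / 60
        + (1 - 25 * w) * (1 - 36 * w) * Z ^ 3 / 1260
        - (1 - 25 * w) * (1 - 36 * w) * (1 - 49 * w) * Z ^ 4 / 40320) := by
      rw [t4, t3, t2, t1]
      ring
    linarith
  rw [abs_le]
  constructor
  · have : -(1 / 5) ≤ F := by linarith
    nlinarith
  · refine (mul_le_mul_of_nonneg_left hF hZ0).trans ?_
    -- the maximum of this polynomial on `[0, 6]` is near `Z = 4.565`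
    have r1 := mul_nonneg (sq_nonneg (Z - 4565 / 1000)) (sq_nonneg (Z - 5))
    have r2 := mul_nonneg (sq_nonneg (Z - 4565 / 1000)) hZ0
    have r3 := mul_nonneg r1 hZ0
    have r4 := sq_nonneg (Z - 4565 / 1000)
    have r5 := mul_nonneg r2 hZ0
    have r6 := mul_nonneg r5 (sub_nonneg.2 hZ)
    have r7 := mul_nonneg r4 (sub_nonneg.2 hZ)
    nlinarith only [r1, r2, r3, r4, r5, r6, r7, hZ0, hZ]

/-- The data of the Sonin function at its starting point; `36 * 0.086` is just below `1.76²`. -/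
theorem sonin_data_le {j : ℕ} (hj : 29 ≤ j) {z₁ : ℝ} (hz₁ : ((j : ℝ) + 4) ^ 2 * z₁ = 6) :
    (hypPoly j (j + 8) 5).eval z₁ ^ 2 + ((3 - 5 * z₁) / 2 * (hypPoly j (j + 8) 5).eval z₁
      + z₁ * (1 - z₁) * (derivative (hypPoly j (j + 8) 5)).eval z₁) ^ 2
        / soninDen ((j : ℝ) + 4) z₁ ≤ 86 / 1000 := by
  have hj' : (29 : ℝ) ≤ j := by exact_mod_cast hj
  have hn2 : 0 < ((j : ℝ) + 4) ^ 2 := by positivity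
  obtain ⟨w, hw⟩ : ∃ w, w * ((j : ℝ) + 4) ^ 2 = 1 := ⟨_, inv_mul_cancel₀ hn2.ne'⟩
  have hw0 : 0 < w := pos_of_mul_pos_left (hw ▸ one_pos) hn2.le
  have hw1 : w ≤ 1 / 1089 := by
    have : (1089 : ℝ) ≤ ((j : ℝ) + 4) ^ 2 := by nlinarith
    nlinarith
  have e1 : z₁ = 6 * w := by
    have : ((j : ℝ) + 4) ^ 2 * (z₁ - 6 * w) = 0 := by linarith
    rcases mul_eq_zero.1 this with h | h
    · exact absurd h hn2.ne'
    · linarith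
  have hz1 : 0 ≤ z₁ := by linarith
  obtain ⟨h1, h2⟩ := jacobi_eval_mem j hz1 hz₁.le
  obtain ⟨d1, d2⟩ := jacobi_derivative_mem j hz1 hz₁.le
  obtain ⟨t1, t2, t3, t4⟩ := jacobiTerm_values j hz₁ hw
  generalize jacobiTerm j z₁ 1 = a1 at *
  generalize jacobiTerm j z₁ 2 = a2 at *
  generalize jacobiTerm j z₁ 3 = a3 at *
  generalize jacobiTerm j z₁ 4 = a4 at *
  have hq : 22 / 10 ≤ soninDen ((j : ℝ) + 4) z₁ := by
    rw [soninDen, show (((j : ℝ) + 4) ^ 2 - 8) * z₁ = 6 - 48 * w by rw [e1]; linarith, e1]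
    nlinarith [mul_nonneg hw0.le (sub_nonneg.2 hw1)]
  generalize soninDen ((j : ℝ) + 4) z₁ = q at *
  generalize (hypPoly j (j + 8) 5).eval z₁ = F at *
  generalize (derivative (hypPoly j (j + 8) 5)).eval z₁ = F' at *
  have hww : w ^ 2 ≤ w / 1089 := by nlinarith
  have hw2 : 0 ≤ w ^ 2 := sq_nonneg w
  have b1 : a1 = 6 / 5 - 96 / 5 * w := by rw [t1]; ring
  have b2 : a2 = 3 / 5 - 123 / 5 * w + 240 * w ^ 2 := by rw [t2, b1]; ring
  have b3 : a3 = 2 / 7 * (3 / 5 - 231 / 5 * w + (240 + 123 * 36 / 5) * w ^ 2 - 8640 * w ^ 3) := by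
    rw [t3, b2]; ring
  have c3 : 0 ≤ w ^ 3 := by positivity
  have c4 : w ^ 3 ≤ w / 1089 ^ 2 := by nlinarith
  have hlow : 228 / 1000 ≤ F := by
    rw [b1, b2, b3] at h1
    linarith
  have b4 : a4 ≤ 3 / 16 * a3 := by
    have : 0 ≤ a3 := by rw [b3]; linarith
    nlinarith
  have hup : F ≤ 266 / 1000 := by
    rw [b3] at b4
    rw [b1, b2, b3] at h2
    linarith
  have dlow : -(515 / 1000) ≤ z₁ * F' := by
    rw [b1, b2, b3] at d1
    linarith
  have dup : z₁ * F' ≤ -(38 / 100) := by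
    rw [b3] at b4
    rw [b1, b2, b3] at d2
    linarith
  have hW : ((3 - 5 * z₁) / 2 * F + z₁ * (1 - z₁) * F') ^ 2 ≤ (18 / 100) ^ 2 := by
    have hz1' : z₁ ≤ 6 / 1089 := by linarith
    have p1 := mul_nonneg hz1 (show 0 ≤ F by linarith)
    have p2 := mul_nonneg hz1 (show 0 ≤ -(z₁ * F') by linarith)
    have p3 := mul_le_mul hz1' hup (by linarith) (by norm_num)
    have p4 := mul_le_mul hz1' (show -(z₁ * F') ≤ 515 / 1000 by linarith) (by linarith)
      (by norm_num)
    refine sq_le_sq' ?_ ?_ <;> linarith only [p1, p2, p3, p4, hlow, hup, dlow, dup]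
  have : ((3 - 5 * z₁) / 2 * F + z₁ * (1 - z₁) * F') ^ 2 / q ≤ 15 / 1000 := by
    rw [div_le_iff₀ (by linarith)]
    linarith
  have : F ^ 2 ≤ (266 / 1000) ^ 2 := pow_le_pow_left₀ (by linarith) hup 2
  linarith

theorem abs_jacobi_le {j : ℕ} (hj : 29 ≤ j) {z : ℝ} (hz : 0 ≤ z) (hz2 : z ≤ 1 / 2) :
    |((j : ℝ) + 4) ^ 2 * z * (hypPoly j (j + 8) 5).eval z| ≤ 2 * (88 / 100) := by
  have hn2 : 0 < ((j : ℝ) + 4) ^ 2 := by positivity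
  rcases le_total (((j : ℝ) + 4) ^ 2 * z) 6 with hZ | hZ
  · exact abs_jacobi_le_of_le_six hj hz hZ
  · obtain ⟨z₁, hz₁⟩ : ∃ z₁, ((j : ℝ) + 4) ^ 2 * z₁ = 6 := ⟨6 / _, mul_div_cancel₀ _ hn2.ne'⟩
    have hV := sq_jacobi_le_of_sonin (by omega) hz₁ (sonin_data_le hj hz₁) (z := z)
      (le_of_mul_le_mul_left (hz₁.le.trans hZ) hn2) hz2
    refine abs_le.2 (abs_le_of_sq_le_sq' ?_ (by norm_num))
    linarith

/-- The constant is close to optimal: `(k + 3) c_k` is about `0.855` at `k = 30`, and its limit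
`max 48 J₄(t) / t²` is about `0.845`. -/
theorem c_le_of_thirty_le {k : ℕ} (hk : 30 ≤ k) : c k ≤ 88 / 100 / ((k : ℝ) + 3) := by
  obtain ⟨j, rfl⟩ : ∃ j, k = j + 1 := ⟨k - 1, by omega⟩
  rw [show (((j + 1 : ℕ) : ℝ) + 3) = (j : ℝ) + 4 by push_cast; ring]
  exact c_succ_le fun z hz hz2 => abs_jacobi_le (by omega) hz hz2

/-! ### Gains from splitting `a = a₊ + a₋` -/

/-- The gain in the second regime, normalized by `a = 1`; `τ` stands for `λ_k a` and `q` for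
`(1 - b) d / (4 τ)`. For fixed `m τ` the hypothesis `hΨ` is linear in `τ ≥ 2 m τ`. -/
theorem gain_of_le {τ q m κ : ℝ} (hτ : 0 < τ) (hq : q * τ = 134 / 100) (hm : 0 ≤ m)
    (hΨ : 0 ≤ τ * (2178 / 10000 - 2 * κ) - 1089 / 10000 * (m * τ) + 8844 / 10000
      - m * τ * (1 - 67 / 800 * (m * τ)) ^ 2 + 2 * κ * (m * τ)) :
    (33 / 100 * (1 - m) + q) ^ 2 + (m - 67 / 800 * τ * m ^ 2) ^ 2 + 2 * (1 - m) * m * κ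
      ≤ (33 / 100 + q) ^ 2 := by
  refine le_of_mul_le_mul_right ?_ hτ
  have h := mul_nonneg hm hΨ
  have e : ((33 / 100 + q) ^ 2 - ((33 / 100 * (1 - m) + q) ^ 2
      + (m - 67 / 800 * τ * m ^ 2) ^ 2 + 2 * (1 - m) * m * κ)) * τ
      = m * (τ * (2178 / 10000 - 2 * κ) - 1089 / 10000 * (m * τ) + 8844 / 10000
      - m * τ * (1 - 67 / 800 * (m * τ)) ^ 2 + 2 * κ * (m * τ)) := by
    linear_combination (66 / 100 * m) * hq
  linarith

/-- The gain in the second regime when `a₋` is large as well. -/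
theorem gain_of_gt {τ q m κ : ℝ} (hτ : 0 < τ) (hq : q * τ = 134 / 100) (hm : m ≤ 1 / 2)
    (hmτ : 4 < m * τ) (hκ : κ ≤ 5 / 100) :
    (33 / 100 * (1 - m) + q) ^ 2 + (33 / 100 * m + q) ^ 2 + 2 * (1 - m) * m * κ
      ≤ (33 / 100 + q) ^ 2 := by
  have hm0 : 0 < m := pos_of_mul_pos_left (by linarith) hτ.le
  have hq0 : 0 < q := pos_of_mul_pos_left (by linarith) hτ.le
  have h1 : q ≤ 335 / 1000 * m := by
    refine le_of_mul_le_mul_right ?_ hτ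
    linarith
  have h2 : q ^ 2 ≤ (335 / 1000 * m) ^ 2 := pow_le_pow_left₀ hq0.le h1 2
  nlinarith [mul_nonneg (mul_nonneg hm0.le (show 0 ≤ 1 - m by linarith)) (sub_nonneg.2 hκ),
    mul_nonneg hm0.le (show 0 ≤ 1 - 2 * m by linarith)]

/-- A lower bound `κ` for the gain in the second regime, which depends on the size of
`τ = λ_k a`. -/
def GainConst (τ κ : ℝ) : Prop :=
  κ = 274 / 10000 ∨ (τ ≤ 5 ∧ κ = 276 / 10000) ∨ (τ ≤ 444 / 100 ∧ κ = 31 / 1000)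
    ∨ (τ ≤ 42 / 10 ∧ κ = 34 / 1000) ∨ (8 ≤ τ ∧ κ = 5 / 100)

theorem gain_second {τ q m κ : ℝ} (hτ : 0 < τ) (hq : q * τ = 134 / 100) (hm0 : 0 ≤ m)
    (hm : m ≤ 1 / 2) (hκ : GainConst τ κ) :
    (33 / 100 * (1 - m) + q) ^ 2
      + (if m * τ ≤ 4 then m - 67 / 800 * τ * m ^ 2 else 33 / 100 * m + q) ^ 2
      + 2 * (1 - m) * m * κ ≤ (33 / 100 + q) ^ 2 := by
  split_ifs with h
  · refine gain_of_le hτ hq hm0 ?_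
    have hy : 0 ≤ m * τ := by positivity
    have hy2 : 2 * (m * τ) ≤ τ := by nlinarith
    generalize m * τ = y at *
    rcases hκ with rfl | ⟨h5, rfl⟩ | ⟨h5, rfl⟩ | ⟨h5, rfl⟩ | ⟨h5, rfl⟩
    -- at `τ = 2 y` the remaining cubic in `y` has its minimum near `y = 2.597`
    · nlinarith only [mul_nonneg (sub_nonneg.2 h) (sq_nonneg (y - 2597 / 1000)),
        sq_nonneg (y - 2597 / 1000), hy2]
    · have hY : y ≤ 5 / 2 := by linarith
      nlinarith only [mul_nonneg (sub_nonneg.2 h) (sq_nonneg (5 / 2 - y)), sq_nonneg (5 / 2 - y), hy2, hY]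
    · have hY : y ≤ 222 / 100 := by linarith
      nlinarith only [mul_nonneg (sub_nonneg.2 h) (sq_nonneg (222 / 100 - y)), sq_nonneg (222 / 100 - y), hy2, hY]
    · have hY : y ≤ 21 / 10 := by linarith
      nlinarith only [mul_nonneg (sub_nonneg.2 h) (sq_nonneg (21 / 10 - y)), sq_nonneg (21 / 10 - y), hy2, hY]
    · nlinarith only [mul_nonneg hy (sub_nonneg.2 h), mul_nonneg (mul_nonneg hy hy) (sub_nonneg.2 h),
        mul_nonneg hy (mul_nonneg hy hy), h, hy, h5]
  · push Not at h
    refine gain_of_gt hτ hq hm h ?_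
    rcases hκ with rfl | ⟨-, rfl⟩ | ⟨-, rfl⟩ | ⟨-, rfl⟩ | ⟨-, rfl⟩ <;> norm_num

/-- The gain in the first regime, normalized by `a = 1`; `s` stands for `(1 - b) λ_k a / d`. -/
theorem gain_first {s S m : ℝ} (hs : s ≤ S) (hS : S ≤ 335 / 1000) (hm0 : 0 ≤ m)
    (hm : m ≤ 1 / 2) :
    (1 - m - s * (1 - m) ^ 2) ^ 2 + (m - s * m ^ 2) ^ 2
      + 2 * (1 - m) * m * (1 - 3 * S + 7 / 4 * S ^ 2) ≤ (1 - s) ^ 2 := by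
  have ht : 0 ≤ (1 - m) * m := mul_nonneg (by linarith) hm0
  have ht4 : (1 - m) * m ≤ 1 / 4 := by nlinarith [sq_nonneg (1 - 2 * m)]
  have h1 : 1 - 3 * S + 7 / 4 * S ^ 2 ≤ 1 - 3 * s + 2 * s ^ 2 - s ^ 2 * ((1 - m) * m) := by
    nlinarith [mul_nonneg (sq_nonneg s) (sub_nonneg.2 ht4)]
  have h2 := mul_le_mul_of_nonneg_left h1 ht
  nlinarith

/-! ### Reduction to an inequality between the weights -/

/-- The comparison at one even `k`, once the squares of the bounds at `k` and `k + 1` gain `κ₀` and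
`κ₁` times `2 l (1 - l) a²`. -/
theorem f_le_of_gains {n k : ℕ} {α a l κ₀ κ₁ G₀ G₁ c' : ℝ} (hl : 1 / 2 ≤ l) (hl1 : l ≤ 1)
    (hB₀ : 0 ≤ B n α k) (hB₁ : 0 ≤ B n α (k + 1))
    (h₀ : Aplus n k (l * a) ^ 2 + Aminus k ((1 - l) * a) ^ 2 + 2 * l * (1 - l) * κ₀ * a ^ 2 ≤ G₀)
    (h₁ : Aplus n (k + 1) (l * a) ^ 2 + Aminus (k + 1) ((1 - l) * a) ^ 2
      + 2 * l * (1 - l) * κ₁ * a ^ 2 ≤ G₁)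
    (hi : (B n α k + B n α (k + 1)) * c' + (B n α (k + 1) - B n α k)
      ≤ B n α k * κ₀ + B n α (k + 1) * κ₁)
    (hd : (B n α k + B n α (k + 1)) * c' + 8 / 100 * (B n α k - B n α (k + 1))
      ≤ B n α k * κ₀ + B n α (k + 1) * κ₁) :
    f n α k a l ≤ B n α k * G₀ + B n α (k + 1) * G₁
      + 2 * l * (1 - l) * a ^ 2 * (B n α k + B n α (k + 1)) * (c k - c') := by
  have ht : 0 ≤ 2 * l * (1 - l) * a ^ 2 := by
    have : 0 ≤ 1 - l := by linarith
    positivity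
  have g₀ := mul_le_mul_of_nonneg_left h₀ hB₀
  have g₁ := mul_le_mul_of_nonneg_left h₁ hB₁
  simp only [f, sq_abs, R₃, m₀]
  generalize B n α k = b₀ at *
  generalize B n α (k + 1) = b₁ at *
  split_ifs with hle
  · have := mul_le_mul_of_nonneg_left hi ht
    linarith
  · have h3 := mul_le_mul_of_nonneg_left hd ht
    have h4 : 0 ≤ (b₀ - b₁) * ((1 - l) * a ^ 2 * (2 * l - 1)) := by
      have : 0 ≤ 1 - l := by linarith
      have : 0 ≤ 2 * l - 1 := by linarith
      have : 0 ≤ b₀ - b₁ := by linarith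
      positivity
    linarith

theorem lam_pos {k : ℕ} (hk : 1 ≤ k) : 0 < lam k := by
  have : (1 : ℝ) ≤ k := by exact_mod_cast hk
  unfold lam
  positivity

theorem gain_first_scaled {n k : ℕ} (hk : 1 ≤ k) (hkn : lam k ≤ lam n / 4) {a l S : ℝ} (ha : 0 < a)
    (hl : 1 / 2 ≤ l) (hl1 : l ≤ 1) (hs : 67 / 800 * (lam k * a) ≤ S) (hS : S ≤ 335 / 1000) :
    Aplus n k (l * a) ^ 2 + Aminus k ((1 - l) * a) ^ 2
      + 2 * l * (1 - l) * (1 - 3 * S + 7 / 4 * S ^ 2) * a ^ 2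
      ≤ (a - (1 - b) / d * lam k * a ^ 2) ^ 2 := by
  have hlam := lam_pos hk
  have h := gain_first (m := 1 - l) hs hS (by linarith) (by linarith)
  have hA : (1 - l) * a ≤ 4 / lam k := by
    rw [le_div_iff₀ hlam]
    nlinarith [mul_pos hlam ha]
  rw [Aplus, if_pos hkn, Aminus, if_pos hA, b, d]
  have := mul_le_mul_of_nonneg_right h (sq_nonneg a)
  calc _ = ((1 - (1 - l) - 67 / 800 * (lam k * a) * (1 - (1 - l)) ^ 2) ^ 2
      + (1 - l - 67 / 800 * (lam k * a) * (1 - l) ^ 2) ^ 2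
      + 2 * (1 - (1 - l)) * (1 - l) * (1 - 3 * S + 7 / 4 * S ^ 2)) * a ^ 2 := by ring
    _ ≤ _ := this
    _ = _ := by ring

theorem gain_second_scaled {n k : ℕ} (hk : 1 ≤ k) (hkn : lam n / 4 < lam k) {a l κ : ℝ} (ha : 0 < a)
    (hl : 1 / 2 ≤ l) (hl1 : l ≤ 1) (hκ : GainConst (lam k * a) κ) :
    Aplus n k (l * a) ^ 2 + Aminus k ((1 - l) * a) ^ 2 + 2 * l * (1 - l) * κ * a ^ 2
      ≤ (b * a + (1 - b) * (d / (4 * lam k))) ^ 2 := by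
  have hlam := lam_pos hk
  have hτ : 0 < lam k * a := by positivity
  have h := gain_second (m := 1 - l) hτ (div_mul_cancel₀ (134 / 100) hτ.ne') (by linarith)
    (by linarith) hκ
  have := mul_le_mul_of_nonneg_right h (sq_nonneg a)
  have hiff : (1 - l) * a ≤ 4 / lam k ↔ (1 - l) * (lam k * a) ≤ 4 := by
    rw [le_div_iff₀ hlam]
    constructor <;> intro h <;> linarith
  rw [Aplus, if_neg (not_le.2 hkn), Aminus, b, d]
  have hne := hlam.ne'
  have hae := ha.ne'
  have e1 : 33 / 100 * (l * a) + (1 - 33 / 100) * (8 / (4 * lam k))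
      = (33 / 100 * (1 - (1 - l)) + 134 / 100 / (lam k * a)) * a := by
    field_simp
    ring
  have e2 : 33 / 100 * a + (1 - 33 / 100) * (8 / (4 * lam k))
      = (33 / 100 + 134 / 100 / (lam k * a)) * a := by
    field_simp
    ring
  have e3 : (if (1 - l) * a ≤ 4 / lam k then (1 - l) * a - (1 - 33 / 100) / 8 * lam k
        * ((1 - l) * a) ^ 2
        else 33 / 100 * ((1 - l) * a) + (1 - 33 / 100) * (8 / (4 * lam k)))
      = (if (1 - l) * (lam k * a) ≤ 4 then 1 - l - 67 / 800 * (lam k * a) * (1 - l) ^ 2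
        else 33 / 100 * (1 - l) + 134 / 100 / (lam k * a)) * a := by
    simp only [hiff]
    split_ifs
    · ring
    · field_simp
      ring
  rw [e1, e2, e3]
  linarith

/-! ### The weights `B_k` -/

/-- An inequality between the weights, in terms of `K = k + 3` and
`u = λ_{n+1} - λ_k + 11 / (7 α)`. -/
theorem weight_ineq {n k : ℕ} {α K u c' r κ₀ κ₁ : ℝ} (hK : K = k + 3)
    (hu : u = lam (n + 1) - lam k + 11 / (7 * α))
    (h : 2 * K * (2 * u - 2 * K - 1) * c' + r * (2 * u - 2 * K * (2 * K + 1))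
      ≤ u * (2 * K - 1) * κ₀ + (u - 2 * K) * (2 * K + 1) * κ₁) :
    (B n α k + B n α (k + 1)) * c' + r * (B n α (k + 1) - B n α k)
      ≤ B n α k * κ₀ + B n α (k + 1) * κ₁ := by
  have e₀ : B n α k = 9 * α ^ 2 / 32 * (u * (2 * K - 1)) := by
    rw [B, hu, hK]; ring
  have e₁ : B n α (k + 1) = 9 * α ^ 2 / 32 * ((u - 2 * K) * (2 * K + 1)) := by
    have : lam (k + 1) = lam k + 2 * K := by rw [lam, lam, hK]; push_cast; ring
    rw [B, hu, this, hK]; push_cast; ring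
  rw [e₀, e₁]
  have := mul_le_mul_of_nonneg_left h (show 0 ≤ 9 * α ^ 2 / 32 by positivity)
  linarith

theorem lam_mono {i j : ℕ} (h : i ≤ j) : lam i ≤ lam j := by
  have : (i : ℝ) ≤ j := by exact_mod_cast h
  unfold lam
  gcongr

theorem B_nonneg {n k : ℕ} {α : ℝ} (hα : 1 / 2 ≤ α) (hk : k ≤ n + 1) : 0 ≤ B n α k := by
  have h1 : 0 ≤ lam (n + 1) - lam k := sub_nonneg.2 (lam_mono hk)
  have h2 : 0 ≤ 11 / (7 * α) := by positivity
  unfold B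
  positivity

theorem eleven_div_le {α : ℝ} (hα : 1 / 2 ≤ α) : 11 / (7 * α) ≤ 22 / 7 := by
  rw [div_le_div_iff₀ (by linarith) (by norm_num)]
  linarith

/-! ### The position of `k` relative to `n` -/

/-- For `n = 4 m + 1` the first regime is `k ≤ 2 m - 1`, so that an even `k` and `k + 1` are always
in the same regime. -/
theorem lam_succ_le_quarter {n k : ℕ} (hn : 5 ≤ n) (hn4 : n ≡ 1 [MOD 4]) (hk : Even k)
    (h : lam k ≤ lam n / 4) : lam (k + 1) ≤ lam n / 4 := by
  obtain ⟨m, rfl⟩ : ∃ m, n = 4 * m + 1 := ⟨n / 4, by unfold Nat.ModEq at hn4; omega⟩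
  obtain ⟨r, rfl⟩ := hk
  have hm : (1 : ℝ) ≤ m := by exact_mod_cast (show 1 ≤ m by omega)
  unfold lam at h ⊢
  push_cast at h ⊢
  have hr : r + 1 ≤ m := by
    by_contra hcon
    have : (m : ℝ) ≤ r := by exact_mod_cast (show m ≤ r by omega)
    nlinarith
  have : (r : ℝ) + 1 ≤ m := by exact_mod_cast hr
  nlinarith

theorem le_two_mul_add_one {n k : ℕ} (hn4 : n ≡ 1 [MOD 4]) (hk : Even k)
    (h : lam n / 4 < lam k) : n ≤ 2 * k + 1 := by
  obtain ⟨m, rfl⟩ : ∃ m, n = 4 * m + 1 := ⟨n / 4, by unfold Nat.ModEq at hn4; omega⟩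
  obtain ⟨r, rfl⟩ := hk
  by_contra hcon
  have : (r : ℝ) + 1 ≤ m := by exact_mod_cast (show r + 1 ≤ m by omega)
  unfold lam at h
  push_cast at h
  nlinarith [(Nat.cast_nonneg r : (0 : ℝ) ≤ r)]

theorem succ_le_of_lam_le {n k : ℕ} (hn4 : n ≡ 1 [MOD 4]) (hk : Even k)
    (h : lam k ≤ lam n) : k + 1 ≤ n := by
  have : k ≤ n := by
    by_contra hcon
    have : (n : ℝ) + 1 ≤ k := by exact_mod_cast (show n + 1 ≤ k by omega)
    unfold lam at h
    nlinarith [(Nat.cast_nonneg n : (0 : ℝ) ≤ n)]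
  obtain ⟨r, rfl⟩ := hk
  unfold Nat.ModEq at hn4
  omega

/-! ### The value at the end point -/

/-- At `l = 1` the terms with `a₋ = 0` vanish. -/
theorem f_one {n k : ℕ} {α a : ℝ} (hk : 1 ≤ k) :
    f n α k a 1 = B n α k * Aplus n k a ^ 2 + B n α (k + 1) * Aplus n (k + 1) a ^ 2 := by
  have h0 : ∀ i : ℕ, 1 ≤ i → Aminus i 0 = 0 := fun i hi => by
    rw [Aminus, if_pos (div_nonneg (by norm_num) (lam_pos hi).le)]
    ring
  have hR : R₃ n α k a 1 = 0 := by simp [R₃]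
  rw [f, hR]
  simp only [sub_self, zero_mul, h0 k hk, h0 (k + 1) (by omega), sq_abs, one_mul, mul_zero]
  ring

/-! ### The first regime -/

section FirstRegime

variable {n k : ℕ} {α a l : ℝ}

theorem lam_mul_le_four (hn : 5 ≤ n) (ha : a ≤ d₀ / lam n) (h : lam k ≤ lam n / 4) (ha0 : 0 < a) :
    lam k * a ≤ 4 := by
  have hln := lam_pos (show 1 ≤ n by omega)
  rw [le_div_iff₀ hln, d₀] at ha
  nlinarith [mul_le_mul_of_nonneg_right h ha0.le]

theorem f_le_first (hn : 5 ≤ n) (hα : 1 / 2 ≤ α) (ha0 : 0 < a) (ha : a ≤ d₀ / lam n)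
    (hk2 : 2 ≤ k) (hkn : k + 1 ≤ n) (h₀ : lam k ≤ lam n / 4) (h₁ : lam (k + 1) ≤ lam n / 4)
    (hl : 1 / 2 ≤ l) (hl1 : l ≤ 1) :
    f n α k a l ≤ B n α k * (a - (1 - b) / d * lam k * a ^ 2) ^ 2
      + B n α (k + 1) * (a - (1 - b) / d * lam (k + 1) * a ^ 2) ^ 2
      + 1 / 2 * (B n α k + B n α (k + 1)) * c k * a ^ 2 := by
  have hB₀ := B_nonneg (n := n) hα (show k ≤ n + 1 by omega)
  have hB₁ := B_nonneg (n := n) hα (show k + 1 ≤ n + 1 by omega)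
  have t₀ := lam_mul_le_four hn ha h₀ ha0
  have t₁ := lam_mul_le_four hn ha h₁ ha0
  have hk : (2 : ℝ) ≤ k := by exact_mod_cast hk2
  have hkn' : (k : ℝ) + 1 ≤ n := by exact_mod_cast hkn
  have g₀ := gain_first_scaled (S := 335 / 1000) (by omega) h₀ ha0 hl hl1 (by linarith) (by norm_num)
  have g₁ := gain_first_scaled (S := 335 / 1000) (by omega) h₁ ha0 hl hl1 (by linarith) (by norm_num)
  have hi := weight_ineq (n := n) (k := k) (α := α) (c' := 0) (r := 1) (κ₀ := 19 / 100)
    (κ₁ := 19 / 100) rfl rfl ?_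
  · have := f_le_of_gains (c' := 0) hl hl1 hB₀ hB₁ g₀ g₁ (by linarith) (by linarith)
    have hc := mul_nonneg (mul_nonneg (add_nonneg hB₀ hB₁) (c_nonneg k)) (sq_nonneg a)
    nlinarith [mul_nonneg hc (sq_nonneg (2 * l - 1))]
  · have : 0 ≤ 11 / (7 * α) := by positivity
    have : lam (n + 1) - lam k ≥ 4 * (k + 3) + 2 := by
      unfold lam
      push_cast
      nlinarith
    have hu : 4 * ((k : ℝ) + 3) + 2 ≤ lam (n + 1) - lam k + 11 / (7 * α) := by linarith
    generalize lam (n + 1) - lam k + 11 / (7 * α) = u at hu ⊢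
    nlinarith only [mul_nonneg (sub_nonneg.2 hk) (sub_nonneg.2 hu), hu, hk]

/-- A bound `S` for `(1 - b) λ_{k+1} a / d` for which the resulting gain beats the bound
`4 / (k + 3)` for `c k` with room for the growth of the weights. -/
theorem exists_first_bound (hk2 : 2 ≤ k) (hk : Even k) (ha0 : 0 < a) (ha : a * 4026 ≤ 16)
    (t₁ : lam (k + 1) * a ≤ 4) :
    ∃ S : ℝ, S ≤ 335 / 1000 ∧ 67 / 800 * (lam (k + 1) * a) ≤ S ∧
      9 / 2 ≤ (1 - 3 * S + 7 / 4 * S ^ 2) * ((k : ℝ) + 3) := by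
  rcases (show k ≤ 4 ∨ (6 ≤ k ∧ k ≤ 20) ∨ 22 ≤ k by
    obtain ⟨r, rfl⟩ := hk; omega) with h | ⟨h, h'⟩ | h
  · have hk' : (2 : ℝ) ≤ k := by exact_mod_cast hk2
    refine ⟨167 / 10000, by norm_num, ?_, by linarith⟩
    have : lam (k + 1) ≤ 50 := (lam_mono (show k + 1 ≤ 5 by omega)).trans (by norm_num [lam])
    nlinarith only [mul_le_mul_of_nonneg_right this ha0.le, ha]
  · refine ⟨182 / 1000, by norm_num, ?_, ?_⟩
    · have : lam (k + 1) ≤ 546 := (lam_mono (show k + 1 ≤ 21 by omega)).trans (by norm_num [lam])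
      nlinarith only [mul_le_mul_of_nonneg_right this ha0.le, ha]
    · have : (6 : ℝ) ≤ k := by exact_mod_cast h
      linarith
  · have : (22 : ℝ) ≤ k := by exact_mod_cast h
    exact ⟨335 / 1000, le_rfl, by linarith, by linarith⟩

/-- In the first regime the weights increase if `n ≥ 61`. -/
theorem weights_increase (hn : 61 ≤ n) (hk2 : 2 ≤ k) (h₀ : lam k ≤ lam n / 4) :
    2 * ((k : ℝ) + 3) * (2 * (k + 3) + 1) ≤ 2 * (lam (n + 1) - lam k) := by
  have hk' : (2 : ℝ) ≤ k := by exact_mod_cast hk2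
  have e : lam k = ((k : ℝ) + 3) ^ 2 - (k + 3) - 6 := by rw [lam]; ring
  have h4 : 4 * lam k ≤ lam (n + 1) := by
    have := lam_mono (show n ≤ n + 1 by omega)
    linarith
  have h5 : 4154 ≤ lam (n + 1) := (lam_mono (show 62 ≤ n + 1 by omega)).trans' (by norm_num [lam])
  generalize lam (n + 1) = L at *
  rw [e] at h4 ⊢
  rcases le_total ((k : ℝ) + 3) 7 with h7 | h7 <;> nlinarith only [h4, h5, h7, hk']

theorem f_le_first_of_large (hn : 61 ≤ n) (hα : 1 / 2 ≤ α) (ha0 : 0 < a) (ha : a ≤ d₀ / lam n)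
    (hk2 : 2 ≤ k) (hk : Even k) (hkn : k + 1 ≤ n) (h₀ : lam k ≤ lam n / 4)
    (h₁ : lam (k + 1) ≤ lam n / 4) (hl : 1 / 2 ≤ l) (hl1 : l ≤ 1) :
    f n α k a l ≤ B n α k * (a - (1 - b) / d * lam k * a ^ 2) ^ 2
      + B n α (k + 1) * (a - (1 - b) / d * lam (k + 1) * a ^ 2) ^ 2 := by
  have hB₀ := B_nonneg (n := n) hα (show k ≤ n + 1 by omega)
  have hB₁ := B_nonneg (n := n) hα (show k + 1 ≤ n + 1 by omega)
  have hc4 := c_le_four hk2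
  have hk' : (2 : ℝ) ≤ k := by exact_mod_cast hk2
  rw [le_div_iff₀ (by linarith)] at hc4
  have ha' : a * 4026 ≤ 16 := by
    rw [le_div_iff₀ (lam_pos (by omega)), d₀] at ha
    have : 4026 ≤ lam n := (lam_mono hn).trans' (by norm_num [lam])
    nlinarith only [mul_le_mul_of_nonneg_left this ha0.le, ha]
  have t₁ := lam_mul_le_four (by omega) ha h₁ ha0
  have hmono : lam k * a ≤ lam (k + 1) * a :=
    mul_le_mul_of_nonneg_right (lam_mono (by omega)) ha0.le
  obtain ⟨S, hS, hs, hκ⟩ := exists_first_bound hk2 hk ha0 ha' t₁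
  have g₀ := gain_first_scaled (by omega) h₀ ha0 hl hl1 (by linarith) hS
  have g₁ := gain_first_scaled (by omega) h₁ ha0 hl hl1 hs hS
  generalize 1 - 3 * S + 7 / 4 * S ^ 2 = κ at *
  have hu0 : 0 ≤ 11 / (7 * α) := by positivity
  have hinc := weights_increase hn hk2 h₀
  have hw : ∀ r : ℝ, r ≤ 1 → _ := fun r hr => weight_ineq (n := n) (k := k) (α := α) (c' := c k)
    (r := r) (κ₀ := κ) (κ₁ := κ) rfl rfl (by
      have hu : 2 * ((k : ℝ) + 3) * (2 * (k + 3) + 1)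
        ≤ 2 * (lam (n + 1) - lam k + 11 / (7 * α)) := by linarith
      generalize lam (n + 1) - lam k + 11 / (7 * α) = u at hu ⊢
      have h1 : 1 / 2 ≤ (κ - c k) * ((k : ℝ) + 3) := by linarith
      have h2 : 0 ≤ 2 * u - 2 * ((k : ℝ) + 3) - 1 := by nlinarith only [hu, hk']
      have h3 := mul_le_mul_of_nonneg_right h1 h2
      have h4 := mul_le_mul_of_nonneg_right hr (sub_nonneg.2 hu)
      nlinarith only [h3, h4, hk'])
  have := f_le_of_gains (c' := c k) hl hl1 hB₀ hB₁ g₀ g₁ (by linarith [hw 1 le_rfl])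
    (by linarith [hw (-(8 / 100)) (by norm_num)])
  linarith

end FirstRegime

/-! ### The second regime -/

section SecondRegime

variable {n k : ℕ} {α a l : ℝ}

/-- The range of `u` in `weight_ineq` in the second regime. -/
theorem weight_param_mem (hα : 1 / 2 ≤ α) (hkn : k + 1 ≤ n) (hn : n ≤ 2 * k + 1) :
    lam (n + 1) - lam k + 11 / (7 * α) ∈ Set.Icc (4 * ((k : ℝ) + 3) + 2)
      (3 * ((k : ℝ) + 3) ^ 2 - 5 * ((k : ℝ) + 3) + 6) := by
  have h0 : 0 ≤ 11 / (7 * α) := by positivity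
  have h1 := eleven_div_le hα
  have h2 := lam_mono (show k + 2 ≤ n + 1 by omega)
  have h3 := lam_mono (show n + 1 ≤ 2 * k + 2 by omega)
  simp only [lam] at *
  push_cast at *
  constructor <;> nlinarith only [h0, h1, h2, h3]

theorem f_le_second (hα : 1 / 2 ≤ α) (ha0 : 0 < a) (hk2 : 2 ≤ k) (hkn : k + 1 ≤ n)
    (hn : n ≤ 2 * k + 1) (h : lam n / 4 < lam k) (hl : 1 / 2 ≤ l) (hl1 : l ≤ 1) :
    f n α k a l ≤ B n α k * (b * a + (1 - b) * (d / (4 * lam k))) ^ 2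
      + B n α (k + 1) * (b * a + (1 - b) * (d / (4 * lam (k + 1)))) ^ 2
      + 1 / 2 * (B n α k + B n α (k + 1)) * c k * a ^ 2 := by
  have hB₀ := B_nonneg (n := n) hα (show k ≤ n + 1 by omega)
  have hB₁ := B_nonneg (n := n) hα (show k + 1 ≤ n + 1 by omega)
  have h' := h.trans_le (lam_mono (show k ≤ k + 1 by omega))
  have g₀ := gain_second_scaled (by omega) h ha0 hl hl1 (Or.inl rfl)
  have g₁ := gain_second_scaled (by omega) h' ha0 hl hl1 (Or.inl rfl)
  obtain ⟨hu1, hu2⟩ := weight_param_mem hα hkn hn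
  have hK : (5 : ℝ) ≤ (k : ℝ) + 3 := by
    have : (2 : ℝ) ≤ k := by exact_mod_cast hk2
    linarith
  have hw : ∀ r : ℝ, r = 1 ∨ r = -(8 / 100) → _ := fun r hr => weight_ineq (n := n) (k := k)
    (α := α) (c' := 0) (r := r) (κ₀ := 274 / 10000) (κ₁ := 274 / 10000) rfl rfl (by
      generalize lam (n + 1) - lam k + 11 / (7 * α) = u at *
      generalize (k : ℝ) + 3 = K at *
      have p1 := mul_nonneg (sub_nonneg.2 hK) (sub_nonneg.2 hu1)
      have p2 := mul_nonneg (sub_nonneg.2 hK) (sub_nonneg.2 hu2)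
      have p3 := mul_nonneg (sub_nonneg.2 hK) (sq_nonneg K)
      have p4 := mul_nonneg (sub_nonneg.2 hK) (sub_nonneg.2 hK)
      rcases hr with rfl | rfl
      -- the inequality is linear in `u`, with leading coefficient `2 (0.0548 K - 1)`
      · rcases le_total (548 / 10000 * K) 1 with h1 | h1
        · nlinarith only [mul_nonneg (sub_nonneg.2 h1) (sub_nonneg.2 hu2), p3, p4, hK]
        · nlinarith only [mul_nonneg (sub_nonneg.2 h1) (sub_nonneg.2 hu1), p3, p4, hK, hu1]
      · nlinarith only [p1, p2, p3, p4, hK, hu1, hu2])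
  have := f_le_of_gains (c' := 0) hl hl1 hB₀ hB₁ g₀ g₁ (by linarith [hw 1 (Or.inl rfl)])
    (by linarith [hw _ (Or.inr rfl)])
  have hc := mul_nonneg (mul_nonneg (add_nonneg hB₀ hB₁) (c_nonneg k)) (sq_nonneg a)
  nlinarith [mul_nonneg hc (sq_nonneg (2 * l - 1))]

/-- The six pairs `(k, n)` with `k < 36` in the second regime for `n ≥ 61`. -/
theorem exists_second_gains_of_lt (hn61 : 61 ≤ n) (hn4 : n ≡ 1 [MOD 4]) (hα : 1 / 2 ≤ α)
    (ha0 : 0 < a) (ha' : a ≤ d₀ / lam n) (hk : Even k) (hn : n ≤ 2 * k + 1) (hk36 : k < 36) :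
    ∃ κ₀ κ₁ : ℝ, GainConst (lam k * a) κ₀ ∧ GainConst (lam (k + 1) * a) κ₁ ∧
      ∀ r : ℝ, r = 1 ∨ r = -(8 / 100) →
        (B n α k + B n α (k + 1)) * c k + r * (B n α (k + 1) - B n α k)
          ≤ B n α k * κ₀ + B n α (k + 1) * κ₁ := by
  have hc := c_le_of_thirty_le (show 30 ≤ k by
    obtain ⟨r, rfl⟩ := hk; unfold Nat.ModEq at hn4; omega)
  rw [le_div_iff₀ (by positivity)] at hc
  have h0 : 0 ≤ 11 / (7 * α) := by positivity
  have h1 := eleven_div_le hα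
  rw [le_div_iff₀ (lam_pos (by omega)), d₀] at ha'
  have key : ∀ κ₀ κ₁ u : ℝ, u = lam (n + 1) - lam k + 11 / (7 * α) →
      2 * ((k : ℝ) + 3) * (2 * (k + 3) + 1) ≤ 2 * u →
      88 / 100 * 2 * (2 * u - 2 * ((k : ℝ) + 3) - 1) + (2 * u - 2 * (k + 3) * (2 * (k + 3) + 1))
        ≤ u * (2 * ((k : ℝ) + 3) - 1) * κ₀ + (u - 2 * (k + 3)) * (2 * (k + 3) + 1) * κ₁ →
      ∀ r : ℝ, r = 1 ∨ r = -(8 / 100) →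
        (B n α k + B n α (k + 1)) * c k + r * (B n α (k + 1) - B n α k)
          ≤ B n α k * κ₀ + B n α (k + 1) * κ₁ := by
    intro κ₀ κ₁ u hu hinc hu' r hr
    refine weight_ineq rfl hu ?_
    have hr1 : r ≤ 1 := by rcases hr with rfl | rfl <;> norm_num
    have p1 := mul_le_mul_of_nonneg_right hr1 (sub_nonneg.2 hinc)
    have hK : (0 : ℝ) ≤ k := k.cast_nonneg
    have p2 : 0 ≤ 2 * u - 2 * ((k : ℝ) + 3) - 1 := by nlinarith only [hinc, hK]
    have p3 := mul_le_mul_of_nonneg_right hc p2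
    linarith only [p1, p3, hu']
  have hcases : (k = 30 ∧ n = 61) ∨ (k = 32 ∧ n = 61) ∨ (k = 32 ∧ n = 65) ∨ (k = 34 ∧ n = 61)
      ∨ (k = 34 ∧ n = 65) ∨ (k = 34 ∧ n = 69) := by
    obtain ⟨r, rfl⟩ := hk
    unfold Nat.ModEq at hn4
    omega
  rcases hcases with ⟨rfl, rfl⟩ | ⟨rfl, rfl⟩ | ⟨rfl, rfl⟩ | ⟨rfl, rfl⟩ | ⟨rfl, rfl⟩ | ⟨rfl, rfl⟩ <;>
    norm_num [lam] at ha' key ⊢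
  · refine ⟨34 / 1000, ?_, 31 / 1000, ?_, key _ _ ?_ ?_⟩
    · exact Or.inr (Or.inr (Or.inr (Or.inl ⟨by linarith, rfl⟩)))
    · exact Or.inr (Or.inr (Or.inl ⟨by linarith, rfl⟩))
    · linarith
    · linarith
  · refine ⟨276 / 10000, ?_, 276 / 10000, ?_, key _ _ ?_ ?_⟩
    · exact Or.inr (Or.inl ⟨by linarith, rfl⟩)
    · exact Or.inr (Or.inl ⟨by linarith, rfl⟩)
    · linarith
    · linarith
  · refine ⟨31 / 1000, ?_, 31 / 1000, ?_, key _ _ ?_ ?_⟩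
    · exact Or.inr (Or.inr (Or.inl ⟨by linarith, rfl⟩))
    · exact Or.inr (Or.inr (Or.inl ⟨by linarith, rfl⟩))
    · linarith
    · linarith
  · refine ⟨274 / 10000, Or.inl rfl, 274 / 10000, Or.inl rfl, key _ _ ?_ ?_⟩
    · linarith
    · linarith
  · refine ⟨274 / 10000, Or.inl rfl, 274 / 10000, Or.inl rfl, key _ _ ?_ ?_⟩
    · linarith
    · linarith
  · refine ⟨31 / 1000, ?_, 31 / 1000, ?_, key _ _ ?_ ?_⟩
    · exact Or.inr (Or.inr (Or.inl ⟨by linarith, rfl⟩))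
    · exact Or.inr (Or.inr (Or.inl ⟨by linarith, rfl⟩))
    · linarith
    · linarith

/-- For `n ≥ 61` the gains exceed the sharp bound for `c k` together with the variation of the
weights. -/
theorem exists_second_gains (hn61 : 61 ≤ n) (hn4 : n ≡ 1 [MOD 4]) (hα : 1 / 2 ≤ α)
    (ha : d₀ / lam (n + 4) ≤ a) (ha' : a ≤ d₀ / lam n) (hk : Even k)
    (hkn : k + 1 ≤ n) (hn : n ≤ 2 * k + 1) :
    ∃ κ₀ κ₁ : ℝ, GainConst (lam k * a) κ₀ ∧ GainConst (lam (k + 1) * a) κ₁ ∧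
      ∀ r : ℝ, r = 1 ∨ r = -(8 / 100) →
        (B n α k + B n α (k + 1)) * c k + r * (B n α (k + 1) - B n α k)
          ≤ B n α k * κ₀ + B n α (k + 1) * κ₁ := by
  obtain ⟨hu1, hu2⟩ := weight_param_mem hα hkn hn
  have ha0 : 0 < a := lt_of_lt_of_le (div_pos (by norm_num [d₀]) (lam_pos (by omega))) ha
  rcases lt_or_ge k 36 with hk36 | hk36
  · exact exists_second_gains_of_lt hn61 hn4 hα ha0 ha' hk hn hk36
  have hc := c_le_of_thirty_le (show 30 ≤ k by omega)
  rw [le_div_iff₀ (by positivity)] at hc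
  have hK : (39 : ℝ) ≤ (k : ℝ) + 3 := by
    have : (36 : ℝ) ≤ k := by exact_mod_cast hk36
    linarith
  have e : lam k = ((k : ℝ) + 3) ^ 2 - (k + 3) - 6 := by rw [lam]; ring
  rcases le_total 8 (lam k * a) with h8 | h8
  · have h8' : 8 ≤ lam (k + 1) * a :=
      h8.trans (mul_le_mul_of_nonneg_right (lam_mono (by omega)) ha0.le)
    refine ⟨5 / 100, 5 / 100, Or.inr (Or.inr (Or.inr (Or.inr ⟨h8, rfl⟩))),
      Or.inr (Or.inr (Or.inr (Or.inr ⟨h8', rfl⟩))), fun r hr => weight_ineq rfl rfl ?_⟩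
    generalize lam (n + 1) - lam k + 11 / (7 * α) = u at *
    generalize (k : ℝ) + 3 = K at *
    have p1 : 0 ≤ 2 * u - 2 * K - 1 := by linarith
    have p2 := mul_le_mul_of_nonneg_right hc p1
    have p3 := mul_nonneg (sub_nonneg.2 hK) p1
    have p4 := mul_nonneg (sub_nonneg.2 hK) (sub_nonneg.2 hK)
    have p5 := mul_nonneg (sub_nonneg.2 hK) (sub_nonneg.2 hu1)
    rcases hr with rfl | rfl <;> nlinarith only [p1, p2, p3, p4, p5, hK, hu1, hu2]
  · refine ⟨274 / 10000, 274 / 10000, Or.inl rfl, Or.inl rfl, fun r hr => weight_ineq rfl rfl ?_⟩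
    -- `a` cannot be small compared with `1 / λ_n`, so that `λ_k` is far below `λ_n`
    have hu3 : ((k : ℝ) + 3) ^ 2 - 13 * (k + 3) - 6 ≤ lam (n + 1) - lam k + 11 / (7 * α) := by
      rw [div_le_iff₀ (lam_pos (by omega)), d₀] at ha
      have h2 : 2 * lam k ≤ lam (n + 4) := by
        refine le_of_mul_le_mul_right ?_ ha0
        linarith
      have h3 : lam (n + 4) = lam (n + 1) + 6 * n + 30 := by
        unfold lam; push_cast; ring
      have h4 : (n : ℝ) ≤ 2 * k + 1 := by exact_mod_cast hn
      have h0 : 0 ≤ 11 / (7 * α) := by positivity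
      linarith
    generalize lam (n + 1) - lam k + 11 / (7 * α) = u at *
    generalize (k : ℝ) + 3 = K at *
    have p1 : 0 ≤ 2 * u - 2 * K - 1 := by linarith
    have p2 := mul_le_mul_of_nonneg_right hc p1
    have p3 := mul_nonneg (sub_nonneg.2 hK) p1
    have p4 := mul_nonneg (sub_nonneg.2 hK) (sub_nonneg.2 hK)
    rcases hr with rfl | rfl <;> nlinarith only [p1, p2, p3, p4, hK, hu1, hu2, hu3]

theorem f_le_second_of_large (hn61 : 61 ≤ n) (hn4 : n ≡ 1 [MOD 4]) (hα : 1 / 2 ≤ α) (ha0 : 0 < a)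
    (ha : d₀ / lam (n + 4) ≤ a) (ha' : a ≤ d₀ / lam n) (hk : Even k) (hkn : k + 1 ≤ n)
    (hn : n ≤ 2 * k + 1) (h : lam n / 4 < lam k) (hl : 1 / 2 ≤ l) (hl1 : l ≤ 1) :
    f n α k a l ≤ B n α k * (b * a + (1 - b) * (d / (4 * lam k))) ^ 2
      + B n α (k + 1) * (b * a + (1 - b) * (d / (4 * lam (k + 1)))) ^ 2 := by
  have hB₀ := B_nonneg (n := n) hα (show k ≤ n + 1 by omega)
  have hB₁ := B_nonneg (n := n) hα (show k + 1 ≤ n + 1 by omega)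
  have h' := h.trans_le (lam_mono (show k ≤ k + 1 by omega))
  obtain ⟨κ₀, κ₁, hκ₀, hκ₁, hw⟩ := exists_second_gains hn61 hn4 hα ha ha' hk hkn hn
  have g₀ := gain_second_scaled (by omega) h ha0 hl hl1 hκ₀
  have g₁ := gain_second_scaled (by omega) h' ha0 hl hl1 hκ₁
  have := f_le_of_gains (c' := c k) hl hl1 hB₀ hB₁ g₀ g₁ (by linarith [hw 1 (Or.inl rfl)])
    (by linarith [hw _ (Or.inr rfl)])
  linarith

end SecondRegime

end S6

theorem mainTheorem4 (n : ℕ) (hn : 5 ≤ n) (hn4 : n ≡ 1 [MOD 4]) (α : ℝ) (hα : 1 / 2 ≤ α)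
    (a : ℝ) (ha₁ : S6.d₀ / S6.lam (n + 4) ≤ a) (ha₂ : a ≤ S6.d₀ / S6.lam n)
    (k : ℕ) (hk : Even k) (hk2 : 2 ≤ k) :
    (61 ≤ n →
      (S6.lam k ≤ S6.lam n / 4 →
        (∀ l ∈ Set.Icc (1 / 2 : ℝ) 1, S6.f n α k a l ≤ S6.f n α k a 1) ∧
        S6.f n α k a 1 =
          S6.B n α k * (a - (1 - S6.b) / S6.d * S6.lam k * a ^ 2) ^ 2
            + S6.B n α (k + 1) * (a - (1 - S6.b) / S6.d * S6.lam (k + 1) * a ^ 2) ^ 2) ∧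
      (S6.lam n / 4 < S6.lam k → S6.lam k ≤ S6.lam n →
        (∀ l ∈ Set.Icc (1 / 2 : ℝ) 1, S6.f n α k a l ≤ S6.f n α k a 1) ∧
        S6.f n α k a 1 =
          S6.B n α k * (S6.b * a + (1 - S6.b) * (S6.d / (4 * S6.lam k))) ^ 2
            + S6.B n α (k + 1) *
              (S6.b * a + (1 - S6.b) * (S6.d / (4 * S6.lam (k + 1)))) ^ 2)) ∧
    (n ≤ 65 →
      (S6.lam k ≤ S6.lam n / 4 →
        ∀ l ∈ Set.Icc (1 / 2 : ℝ) 1, S6.f n α k a l ≤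
          S6.B n α k * (a - (1 - S6.b) / S6.d * S6.lam k * a ^ 2) ^ 2
            + S6.B n α (k + 1) * (a - (1 - S6.b) / S6.d * S6.lam (k + 1) * a ^ 2) ^ 2
            + 1 / 2 * (S6.B n α k + S6.B n α (k + 1)) * S6.c k * a ^ 2) ∧
      (S6.lam n / 4 < S6.lam k → S6.lam k ≤ S6.lam n →
        ∀ l ∈ Set.Icc (1 / 2 : ℝ) 1, S6.f n α k a l ≤
          S6.B n α k * (S6.b * a + (1 - S6.b) * (S6.d / (4 * S6.lam k))) ^ 2
            + S6.B n α (k + 1) *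
              (S6.b * a + (1 - S6.b) * (S6.d / (4 * S6.lam (k + 1)))) ^ 2
            + 1 / 2 * (S6.B n α k + S6.B n α (k + 1)) * S6.c k * a ^ 2)) := by
  have ha0 : 0 < a := by
    refine lt_of_lt_of_le ?_ ha₁
    have := S6.lam_pos (show 1 ≤ n + 4 by omega)
    unfold S6.d₀
    positivity
  have hmono := S6.lam_mono (show k ≤ k + 1 by omega)
  have hquarter : S6.lam k ≤ S6.lam n / 4 → S6.lam (k + 1) ≤ S6.lam n / 4 ∧ k + 1 ≤ n := fun h =>
    ⟨S6.lam_succ_le_quarter hn hn4 hk h,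
      S6.succ_le_of_lam_le hn4 hk (by linarith [S6.lam_pos (show 1 ≤ n by omega)])⟩
  refine ⟨fun hn61 => ⟨fun h => ?_, fun h h' => ?_⟩,
    fun _ => ⟨fun h l hl => ?_, fun h h' l hl => ?_⟩⟩
  · obtain ⟨h1, hkn⟩ := hquarter h
    have e : S6.f n α k a 1 = _ := S6.f_one (by omega)
    rw [S6.Aplus, S6.Aplus, if_pos h, if_pos h1] at e
    refine ⟨fun l hl => ?_, e⟩
    rw [e]
    exact S6.f_le_first_of_large hn61 hα ha0 ha₂ hk2 hk hkn h h1 hl.1 hl.2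
  · have e : S6.f n α k a 1 = _ := S6.f_one (by omega)
    rw [S6.Aplus, S6.Aplus, if_neg (not_le.2 h), if_neg (not_le.2 (h.trans_le hmono))] at e
    refine ⟨fun l hl => ?_, e⟩
    rw [e]
    exact S6.f_le_second_of_large hn61 hn4 hα ha0 ha₁ ha₂ hk (S6.succ_le_of_lam_le hn4 hk h')
      (S6.le_two_mul_add_one hn4 hk h) h hl.1 hl.2
  · obtain ⟨h1, hkn⟩ := hquarter h
    exact S6.f_le_first hn hα ha0 ha₂ hk2 hkn h h1 hl.1 hl.2
  · exact S6.f_le_second hα ha0 hk2 (S6.succ_le_of_lam_le hn4 hk h') (S6.le_two_mul_add_one hn4 hk h) h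
      hl.1 hl.2
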